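/- An axis-parallel square annulus $A$ is the region between two concentric axis-parallel squares $S'\subseteq S$ of radii (half side lengths) $0\le r'\le r$, where the inner square $S'$ may degenerate to a single point; its width is $r-r'$. For a finite point set $P\subset\mathbb{R}^2$, the annulus is called empty if no point of $P$ lies in its interior, that is, in the interior of $S$ but not in $S'$ (boundary included). An empty annulus is called valid if at least one point of $P$ lies in $S'$ (in its interior or on its boundary) and at least one point of $P$ does not. Theorem. Given a set $P$ of $n\ge 2$ points in the plane, a valid empty axis-parallel square annulus of maximum width can be computed in $O(n^3)$ time using $O(n)$ space. Here the model of computation is the real RAM: memory cells hold either exact real numbers or words of $O(\log n)$ bits, and comparisons, memory accesses (also through computed indices), the operations $+,-,\times,\div$ on reals and $+,-,\times$ on words have unit cost; reals cannot be rounded or converted to words. The input is given as the number $n$ and the coordinates of the points in arbitrary order, and the output consists of the center, the outer radius and the inner radius of the annulus. In detail: there are one program and one constant $C$ such that, for every $n\ge2$ and every set of $n$ points, the program halts after at most $Cn^3$ steps with a correct output, while it uses finitely many registers (a number that depends only on the program), at most $Cn$ cells of each of its finitely many arrays, and only words smaller than $n^C$. -/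

import Mathlib

/-! ### Axis-parallel square annuli -/

/-- The (closed, axis-parallel) square with center `c` and radius `r`, that is, side length `2 * r`. -/
def axisSquare (c : ℝ × ℝ) (r : ℝ) : Set (ℝ × ℝ) :=
  {q | |q.1 - c.1| ≤ r ∧ |q.2 - c.2| ≤ r}

/-- An axis-parallel square annulus, given by two concentric axis-parallel squares, the inner one
contained in the outer one. The inner square may degenerate to the point `center`. -/
structure SquareAnnulus where
  center : ℝ × ℝ
  outerRadius : ℝ
  innerRadius : ℝ
  inner_nonneg : 0 ≤ innerRadius
  inner_le_outer : innerRadius ≤ outerRadius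

namespace SquareAnnulus

def outerSquare (A : SquareAnnulus) : Set (ℝ × ℝ) := axisSquare A.center A.outerRadius

def innerSquare (A : SquareAnnulus) : Set (ℝ × ℝ) := axisSquare A.center A.innerRadius

/-- The region between the two squares. The boundary of the inner square is left out, which changes
the interior only when the inner square is a single point: that point does not belong to it. -/
def region (A : SquareAnnulus) : Set (ℝ × ℝ) := A.outerSquare \ A.innerSquare

def width (A : SquareAnnulus) : ℝ := A.outerRadius - A.innerRadius

/-- No point of `P` lies in the interior of the annulus. -/
def IsEmptyOf (A : SquareAnnulus) (P : Set (ℝ × ℝ)) : Prop := Disjoint (interior A.region) P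

/-- The points of `P` in the interior or on the boundary of the inner square. -/
def pointsIn (A : SquareAnnulus) (P : Set (ℝ × ℝ)) : Set (ℝ × ℝ) := P ∩ A.innerSquare

def pointsOut (A : SquareAnnulus) (P : Set (ℝ × ℝ)) : Set (ℝ × ℝ) := P \ A.pointsIn P

def IsValidFor (A : SquareAnnulus) (P : Set (ℝ × ℝ)) : Prop :=
  (A.pointsOut P).Nonempty ∧ (A.pointsIn P).Nonempty

/-- `A` is a valid empty square annulus for `P`, of maximum width among all of these. -/
def IsMaxWidthValidEmpty (A : SquareAnnulus) (P : Set (ℝ × ℝ)) : Prop :=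
  A.IsEmptyOf P ∧ A.IsValidFor P ∧
    ∀ B : SquareAnnulus, B.IsEmptyOf P → B.IsValidFor P → B.width ≤ A.width

end SquareAnnulus

/-! ### The real RAM

A real RAM works on words (natural numbers below a limit) and on exact real numbers. Programs are
structured. A program refers by literal indices to its registers and arrays, of which it therefore
has finitely many; array cells are addressed by computed words. There is no operation that turns
a real number into a word. -/

namespace RealRAM

/-- `cells` is the number of cells of each array, and every word is below `wordBound`. An access
outside the array or a word that is too large is illegal. -/
structure Limits where
  cells : ℕ
  wordBound : ℕ

/-- Memory contents: registers, and the arrays (array name, then index). -/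
structure Memory where
  wordReg : ℕ → ℕ
  realReg : ℕ → ℝ
  wordArr : ℕ → ℕ → ℕ
  realArr : ℕ → ℕ → ℝ

/-- Word expressions; the subtraction is truncated at zero. -/
inductive WordExp : Type where
  | lit (k : ℕ)
  | reg (i : ℕ)
  | get (a : ℕ) (idx : WordExp)
  | add (u v : WordExp)
  | sub (u v : WordExp)
  | mul (u v : WordExp)

/-- Real expressions: rational constants, memory access and the four arithmetic operations. -/
inductive RealExp : Type where
  | lit (q : ℚ)
  | reg (i : ℕ)
  | get (a : ℕ) (idx : WordExp)
  | add (u v : RealExp)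
  | sub (u v : RealExp)
  | mul (u v : RealExp)
  | div (u v : RealExp)

/-- Tests: comparisons of words and of reals, negation, and conjunction evaluated from the left. -/
inductive Test : Type where
  | wordLt (u v : WordExp)
  | realLt (u v : RealExp)
  | neg (b : Test)
  | conj (b c : Test)

inductive Program : Type where
  | nop
  | setWord (i : ℕ) (e : WordExp)
  | setReal (i : ℕ) (e : RealExp)
  | putWord (a : ℕ) (idx : WordExp) (e : WordExp)
  | putReal (a : ℕ) (idx : WordExp) (e : RealExp)
  | seq (c d : Program)
  | cond (b : Test) (c d : Program)
  | loop (b : Test) (c : Program)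

namespace WordExp

def val (m : Memory) : WordExp → ℕ
  | lit k => k
  | reg i => m.wordReg i
  | get a idx => m.wordArr a (idx.val m)
  | add u v => u.val m + v.val m
  | sub u v => u.val m - v.val m
  | mul u v => u.val m * v.val m

/-- The evaluation accesses only existing cells and meets only words below the bound. -/
def Legal (L : Limits) (m : Memory) : WordExp → Prop
  | lit k => k < L.wordBound
  | reg i => m.wordReg i < L.wordBound
  | get a idx => idx.Legal L m ∧ idx.val m < L.cells ∧ m.wordArr a (idx.val m) < L.wordBound
  | add u v => u.Legal L m ∧ v.Legal L m ∧ u.val m + v.val m < L.wordBound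
  | sub u v => u.Legal L m ∧ v.Legal L m
  | mul u v => u.Legal L m ∧ v.Legal L m ∧ u.val m * v.val m < L.wordBound

/-- Each constant, memory access and operation costs one step. -/
def cost : WordExp → ℕ
  | lit _ => 1
  | reg _ => 1
  | get _ idx => idx.cost + 1
  | add u v => u.cost + v.cost + 1
  | sub u v => u.cost + v.cost + 1
  | mul u v => u.cost + v.cost + 1

end WordExp

namespace RealExp

noncomputable def val (m : Memory) : RealExp → ℝ
  | lit q => (q : ℝ)
  | reg i => m.realReg i
  | get a idx => m.realArr a (idx.val m)
  | add u v => u.val m + v.val m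
  | sub u v => u.val m - v.val m
  | mul u v => u.val m * v.val m
  | div u v => u.val m / v.val m

/-- The evaluation accesses only existing cells and never divides by zero. -/
def Legal (L : Limits) (m : Memory) : RealExp → Prop
  | lit _ => True
  | reg _ => True
  | get _ idx => idx.Legal L m ∧ idx.val m < L.cells
  | add u v => u.Legal L m ∧ v.Legal L m
  | sub u v => u.Legal L m ∧ v.Legal L m
  | mul u v => u.Legal L m ∧ v.Legal L m
  | div u v => u.Legal L m ∧ v.Legal L m ∧ v.val m ≠ 0

def cost : RealExp → ℕ
  | lit _ => 1
  | reg _ => 1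
  | get _ idx => idx.cost + 1
  | add u v => u.cost + v.cost + 1
  | sub u v => u.cost + v.cost + 1
  | mul u v => u.cost + v.cost + 1
  | div u v => u.cost + v.cost + 1

end RealExp

namespace Test

def Holds (m : Memory) : Test → Prop
  | wordLt u v => u.val m < v.val m
  | realLt u v => u.val m < v.val m
  | neg b => ¬ b.Holds m
  | conj b c => b.Holds m ∧ c.Holds m

def Legal (L : Limits) (m : Memory) : Test → Prop
  | wordLt u v => u.Legal L m ∧ v.Legal L m
  | realLt u v => u.Legal L m ∧ v.Legal L m
  | neg b => b.Legal L m
  | conj b c => b.Legal L m ∧ (b.Holds m → c.Legal L m)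

def cost : Test → ℕ
  | wordLt u v => u.cost + v.cost + 1
  | realLt u v => u.cost + v.cost + 1
  | neg b => b.cost + 1
  | conj b c => b.cost + c.cost + 1

end Test

namespace Memory

def setWord (m : Memory) (i k : ℕ) : Memory :=
  { m with wordReg := Function.update m.wordReg i k }

noncomputable def setReal (m : Memory) (i : ℕ) (x : ℝ) : Memory :=
  { m with realReg := Function.update m.realReg i x }

def putWord (m : Memory) (a i k : ℕ) : Memory :=
  { m with wordArr := Function.update m.wordArr a (Function.update (m.wordArr a) i k) }

noncomputable def putReal (m : Memory) (a i : ℕ) (x : ℝ) : Memory :=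
  { m with realArr := Function.update m.realArr a (Function.update (m.realArr a) i x) }

/-- The initial memory on the input points `p 0, …, p (n - 1)`: word register `0` holds `n`, the
real arrays `0` and `1` hold the `x`- and the `y`-coordinates, and everything else is zero. -/
noncomputable def input {n : ℕ} (p : Fin n → ℝ × ℝ) : Memory where
  wordReg := fun i => if i = 0 then n else 0
  realReg := fun _ => 0
  wordArr := fun _ _ => 0
  realArr := fun a i =>
    if h : i < n then
      if a = 0 then (p ⟨i, h⟩).1 else if a = 1 then (p ⟨i, h⟩).2 else 0
    else 0

end Memory

/-- `Run L c m t m'`: within the limits `L`, the program `c` started on the memory `m` performs only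
legal operations and halts after exactly `t` steps with the memory `m'`. -/
inductive Run (L : Limits) : Program → Memory → ℕ → Memory → Prop where
  | nop (m : Memory) : Run L Program.nop m 1 m
  | setWord (m : Memory) (i : ℕ) (e : WordExp) (he : e.Legal L m) :
      Run L (Program.setWord i e) m (e.cost + 1) (m.setWord i (e.val m))
  | setReal (m : Memory) (i : ℕ) (e : RealExp) (he : e.Legal L m) :
      Run L (Program.setReal i e) m (e.cost + 1) (m.setReal i (e.val m))
  | putWord (m : Memory) (a : ℕ) (idx e : WordExp) (hidx : idx.Legal L m)
      (hlt : idx.val m < L.cells) (he : e.Legal L m) :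
      Run L (Program.putWord a idx e) m (idx.cost + e.cost + 1)
        (m.putWord a (idx.val m) (e.val m))
  | putReal (m : Memory) (a : ℕ) (idx : WordExp) (e : RealExp) (hidx : idx.Legal L m)
      (hlt : idx.val m < L.cells) (he : e.Legal L m) :
      Run L (Program.putReal a idx e) m (idx.cost + e.cost + 1)
        (m.putReal a (idx.val m) (e.val m))
  | seq (c d : Program) (m₁ m₂ m₃ : Memory) (s t : ℕ)
      (hc : Run L c m₁ s m₂) (hd : Run L d m₂ t m₃) :
      Run L (Program.seq c d) m₁ (s + t) m₃
  | condTrue (b : Test) (c d : Program) (m m' : Memory) (t : ℕ)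
      (hb : b.Legal L m) (h : b.Holds m) (hc : Run L c m t m') :
      Run L (Program.cond b c d) m (b.cost + t + 1) m'
  | condFalse (b : Test) (c d : Program) (m m' : Memory) (t : ℕ)
      (hb : b.Legal L m) (h : ¬ b.Holds m) (hd : Run L d m t m') :
      Run L (Program.cond b c d) m (b.cost + t + 1) m'
  | loopDone (b : Test) (c : Program) (m : Memory)
      (hb : b.Legal L m) (h : ¬ b.Holds m) :
      Run L (Program.loop b c) m (b.cost + 1) m
  | loopStep (b : Test) (c : Program) (m₁ m₂ m₃ : Memory) (s t : ℕ)
      (hb : b.Legal L m₁) (h : b.Holds m₁) (hc : Run L c m₁ s m₂)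
      (hrest : Run L (Program.loop b c) m₂ t m₃) :
      Run L (Program.loop b c) m₁ (b.cost + s + t + 1) m₃

/-- The output convention: the real registers `0, 1, 2, 3` hold the coordinates of the center, the
outer radius and the inner radius of the annulus. -/
def Memory.Outputs (m : Memory) (A : SquareAnnulus) : Prop :=
  m.realReg 0 = A.center.1 ∧ m.realReg 1 = A.center.2 ∧
    m.realReg 2 = A.outerRadius ∧ m.realReg 3 = A.innerRadius

end RealRAM

namespace RealRAM

/-- The program `c` halts when started on `m`, and its running time and its final memory satisfy `Q`. -/
def WP (L : Limits) (c : Program) (m : Memory) (Q : ℕ → Memory → Prop) : Prop :=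
  ∃ t m', Run L c m t m' ∧ Q t m'

section Rules

variable {L : Limits} {m : Memory} {Q : ℕ → Memory → Prop}

theorem WP.mono {c : Program} {R : ℕ → Memory → Prop} (h : WP L c m Q)
    (hQ : ∀ t m', Q t m' → R t m') : WP L c m R := by
  obtain ⟨t, m', hr, hq⟩ := h
  exact ⟨t, m', hr, hQ t m' hq⟩

theorem wp_nop : WP L Program.nop m Q ↔ Q 1 m := by
  constructor
  · rintro ⟨t, m', hr, hq⟩
    cases hr
    exact hq
  · intro h
    exact ⟨_, _, Run.nop m, h⟩

theorem wp_setWord {i : ℕ} {e : WordExp} :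
    WP L (Program.setWord i e) m Q ↔ e.Legal L m ∧ Q (e.cost + 1) (m.setWord i (e.val m)) := by
  constructor
  · rintro ⟨t, m', hr, hq⟩
    cases hr with
    | setWord _ _ _ he => exact ⟨he, hq⟩
  · rintro ⟨he, h⟩
    exact ⟨_, _, Run.setWord m i e he, h⟩

theorem wp_setReal {i : ℕ} {e : RealExp} :
    WP L (Program.setReal i e) m Q ↔ e.Legal L m ∧ Q (e.cost + 1) (m.setReal i (e.val m)) := by
  constructor
  · rintro ⟨t, m', hr, hq⟩
    cases hr with
    | setReal _ _ _ he => exact ⟨he, hq⟩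
  · rintro ⟨he, h⟩
    exact ⟨_, _, Run.setReal m i e he, h⟩

theorem wp_putReal {a : ℕ} {idx : WordExp} {e : RealExp} :
    WP L (Program.putReal a idx e) m Q ↔
      (idx.Legal L m ∧ idx.val m < L.cells ∧ e.Legal L m) ∧
        Q (idx.cost + e.cost + 1) (m.putReal a (idx.val m) (e.val m)) := by
  constructor
  · rintro ⟨t, m', hr, hq⟩
    cases hr with
    | putReal _ _ _ _ h1 h2 h3 => exact ⟨⟨h1, h2, h3⟩, hq⟩
  · rintro ⟨⟨h1, h2, h3⟩, h⟩
    exact ⟨_, _, Run.putReal m a idx e h1 h2 h3, h⟩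

theorem wp_seq {c d : Program} :
    WP L (Program.seq c d) m Q ↔
      WP L c m fun s m' => WP L d m' fun t m'' => Q (s + t) m'' := by
  constructor
  · rintro ⟨t, m', hr, hq⟩
    cases hr with
    | seq _ _ _ m₂ _ s t hc hd => exact ⟨s, m₂, hc, t, m', hd, hq⟩
  · rintro ⟨s, m₂, hc, t, m', hd, hq⟩
    exact ⟨_, _, Run.seq c d m m₂ m' s t hc hd, hq⟩

theorem wp_cond {b : Test} {c d : Program} :
    WP L (Program.cond b c d) m Q ↔
      b.Legal L m ∧ (b.Holds m → WP L c m fun t m' => Q (b.cost + t + 1) m') ∧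
        (¬ b.Holds m → WP L d m fun t m' => Q (b.cost + t + 1) m') := by
  constructor
  · rintro ⟨t, m', hr, hq⟩
    cases hr with
    | condTrue _ _ _ _ _ t hb h hc => exact ⟨hb, fun _ => ⟨t, m', hc, hq⟩, fun h' => absurd h h'⟩
    | condFalse _ _ _ _ _ t hb h hc => exact ⟨hb, fun h' => absurd h' h, fun _ => ⟨t, m', hc, hq⟩⟩
  · rintro ⟨hb, h1, h2⟩
    by_cases h : b.Holds m
    · obtain ⟨t, m', hc, hq⟩ := h1 h
      exact ⟨_, _, Run.condTrue b c d m m' t hb h hc, hq⟩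
    · obtain ⟨t, m', hc, hq⟩ := h2 h
      exact ⟨_, _, Run.condFalse b c d m m' t hb h hc, hq⟩

/-- A loop with invariant `I` whose iterations are paid for by the potential `Φ`. -/
theorem wp_loop {b : Test} {c : Program} (I : Memory → Prop) (Φ : Memory → ℕ)
    (hI : I m) (hb : ∀ m, I m → b.Legal L m)
    (hc : ∀ m, I m → b.Holds m →
      WP L c m fun t m' => I m' ∧ t + b.cost + 1 + Φ m' ≤ Φ m)
    (hQ : ∀ t m', t ≤ Φ m + b.cost + 1 → I m' → ¬ b.Holds m' → Q t m') :
    WP L (Program.loop b c) m Q := by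
  suffices h : ∀ N, ∀ m, Φ m < N → I m → ∃ t m', Run L (Program.loop b c) m t m' ∧
      t ≤ Φ m + b.cost + 1 ∧ I m' ∧ ¬ b.Holds m' by
    obtain ⟨t, m', hr, ht, hI', hb'⟩ := h _ m (Nat.lt_succ_self _) hI
    exact ⟨t, m', hr, hQ t m' ht hI' hb'⟩
  intro N
  induction N with
  | zero => intro m h; omega
  | succ N ih =>
    intro m hm hI
    by_cases h : b.Holds m
    · obtain ⟨s, m', hr, hI', hs⟩ := hc m hI h
      obtain ⟨t, m'', hr', ht, hI'', hb''⟩ := ih m' (by omega) hI'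
      exact ⟨_, m'', Run.loopStep b c m m' m'' s t (hb m hI) h hr hr', by omega, hI'', hb''⟩
    · exact ⟨_, m, Run.loopDone b c m (hb m hI) h, by omega, hI, h⟩

end Rules

section Memory

variable (m : Memory) (i k a : ℕ) (x : ℝ)

@[simp] theorem Memory.setWord_wordReg :
    (m.setWord i k).wordReg = Function.update m.wordReg i k := rfl
@[simp] theorem Memory.setWord_realReg : (m.setWord i k).realReg = m.realReg := rfl
@[simp] theorem Memory.setWord_realArr : (m.setWord i k).realArr = m.realArr := rfl
@[simp] theorem Memory.setReal_wordReg : (m.setReal i x).wordReg = m.wordReg := rfl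
@[simp] theorem Memory.setReal_realReg :
    (m.setReal i x).realReg = Function.update m.realReg i x := rfl
@[simp] theorem Memory.setReal_realArr : (m.setReal i x).realArr = m.realArr := rfl
@[simp] theorem Memory.putReal_wordReg : (m.putReal a i x).wordReg = m.wordReg := rfl
@[simp] theorem Memory.putReal_realReg : (m.putReal a i x).realReg = m.realReg := rfl
@[simp] theorem Memory.putReal_realArr : (m.putReal a i x).realArr =
    Function.update m.realArr a (Function.update (m.realArr a) i x) := rfl

end Memory

/-- Run `c` for the values `0, …, N - 1` of the word register `i`, where `N` is the value of `e`. -/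
def forLoop (i : ℕ) (e : WordExp) (c : Program) : Program :=
  Program.seq (Program.setWord i (WordExp.lit 0))
    (Program.loop (Test.wordLt (WordExp.reg i) e)
      (Program.seq c (Program.setWord i (WordExp.add (WordExp.reg i) (WordExp.lit 1)))))

theorem wp_forLoop {L : Limits} {i : ℕ} {e : WordExp} {c : Program} {m : Memory}
    {Q : ℕ → Memory → Prop} (N T : ℕ) (I : ℕ → Memory → Prop) (hN : N + 1 < L.wordBound)
    (h0 : I 0 (m.setWord i 0))
    (he : ∀ v m, v ≤ N → I v m → e.Legal L m ∧ e.val m = N)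
    (hc : ∀ v m, v < N → m.wordReg i = v → I v m → WP L c m fun t m' =>
      t ≤ T ∧ m'.wordReg i = v ∧ I (v + 1) (m'.setWord i (v + 1)))
    (hQ : ∀ t m', t ≤ N * (T + e.cost + 7) + e.cost + 5 → I N m' → Q t m') :
    WP L (forLoop i e c) m Q := by
  rw [forLoop, wp_seq, wp_setWord]
  refine ⟨by simp only [WordExp.Legal]; omega, ?_⟩
  refine wp_loop (fun m => m.wordReg i ≤ N ∧ I (m.wordReg i) m)
    (fun m => (N - m.wordReg i) * (T + e.cost + 7)) ?_ ?_ ?_ ?_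
  · simpa [WordExp.val] using h0
  · rintro m ⟨hv, hI⟩
    refine ⟨?_, (he _ m hv hI).1⟩
    simp only [WordExp.Legal]
    omega
  · rintro m ⟨hv, hI⟩ hlt
    have hlt' : m.wordReg i < N := by
      have := (he _ m hv hI).2
      simp only [Test.Holds, WordExp.val] at hlt
      omega
    rw [wp_seq]
    refine (hc _ m hlt' rfl hI).mono ?_
    rintro t m' ⟨ht, hv', hI'⟩
    rw [wp_setWord]
    refine ⟨by simp only [WordExp.Legal, WordExp.val]; omega, ?_⟩
    simp only [WordExp.val, hv', Memory.setWord_wordReg, Function.update_self]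
    refine ⟨⟨by omega, hI'⟩, ?_⟩
    simp only [WordExp.cost, Test.cost]
    obtain ⟨d, hd⟩ : ∃ d, N - m.wordReg i = d + 1 := ⟨N - m.wordReg i - 1, by omega⟩
    have hd' : N - (m.wordReg i + 1) = d := by omega
    rw [hd, hd', add_mul]
    omega
  · rintro t m' ht ⟨hv, hI⟩ hlt
    have hN' : m'.wordReg i = N := by
      have := (he _ m' hv hI).2
      simp only [Test.Holds, WordExp.val] at hlt
      omega
    rw [hN'] at hI
    refine hQ _ _ ?_ hI
    simp [WordExp.val, WordExp.cost, Test.cost] at ht ⊢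
    omega

/-- Replace the content of the real register `i` by its minimum with `e`. -/
def setMin (i : ℕ) (e : RealExp) : Program :=
  Program.cond (Test.realLt e (RealExp.reg i)) (Program.setReal i e) Program.nop

/-- Replace the content of the real register `i` by its maximum with `e`. -/
def setMax (i : ℕ) (e : RealExp) : Program :=
  Program.cond (Test.realLt (RealExp.reg i) e) (Program.setReal i e) Program.nop

theorem Memory.setReal_realReg_self (m : Memory) (i : ℕ) : m.setReal i (m.realReg i) = m := by
  simp [Memory.setReal]

theorem wp_setMin {L : Limits} {m : Memory} {Q : ℕ → Memory → Prop} {i : ℕ} {e : RealExp}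
    (he : e.Legal L m)
    (hQ : ∀ t ≤ 2 * e.cost + 4, Q t (m.setReal i (min (m.realReg i) (e.val m)))) :
    WP L (setMin i e) m Q := by
  rw [setMin, wp_cond]
  refine ⟨⟨he, trivial⟩, fun h => ?_, fun h => ?_⟩
  · rw [wp_setReal]
    refine ⟨he, ?_⟩
    simp only [Test.Holds, RealExp.val] at h
    rw [← min_eq_right h.le]
    exact hQ _ (by simp only [Test.cost, RealExp.cost]; omega)
  · rw [wp_nop]
    simp only [Test.Holds, RealExp.val, not_lt] at h
    have := hQ ((Test.realLt e (RealExp.reg i)).cost + 1 + 1)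
      (by simp only [Test.cost, RealExp.cost]; omega)
    rwa [min_eq_left h, Memory.setReal_realReg_self] at this

theorem wp_setMax {L : Limits} {m : Memory} {Q : ℕ → Memory → Prop} {i : ℕ} {e : RealExp}
    (he : e.Legal L m)
    (hQ : ∀ t ≤ 2 * e.cost + 4, Q t (m.setReal i (max (m.realReg i) (e.val m)))) :
    WP L (setMax i e) m Q := by
  rw [setMax, wp_cond]
  refine ⟨⟨trivial, he⟩, fun h => ?_, fun h => ?_⟩
  · rw [wp_setReal]
    refine ⟨he, ?_⟩
    simp only [Test.Holds, RealExp.val] at h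
    rw [← max_eq_right h.le]
    exact hQ _ (by simp only [Test.cost, RealExp.cost]; omega)
  · rw [wp_nop]
    simp only [Test.Holds, RealExp.val, not_lt] at h
    have := hQ ((Test.realLt (RealExp.reg i) e).cost + 1 + 1)
      (by simp only [Test.cost, RealExp.cost]; omega)
    rwa [max_eq_left h, Memory.setReal_realReg_self] at this

end RealRAM

/-! ### Geometry of square annuli -/

theorem axisSquare_eq_closedBall (c : ℝ × ℝ) (r : ℝ) : axisSquare c r = Metric.closedBall c r := by
  ext q
  simp [axisSquare, Prod.dist_eq, Real.dist_eq]

theorem SquareAnnulus.interior_region (A : SquareAnnulus) :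
    interior A.region =
      {q | A.innerRadius < dist q A.center ∧ dist q A.center < A.outerRadius} := by
  have h : A.region = A.outerSquare ∩ A.innerSquareᶜ := rfl
  rw [h, interior_inter, interior_compl]
  simp only [SquareAnnulus.outerSquare, SquareAnnulus.innerSquare, axisSquare_eq_closedBall,
    interior_closedBall', Metric.isClosed_closedBall.closure_eq]
  ext q
  simp [and_comm]

/-- The numbers `cx, cy, r, s` are the center and the radii of a valid empty square annulus of
positive width. -/
structure IsCandidate (P : Set (ℝ × ℝ)) (cx cy r s : ℝ) : Prop where
  nonneg : 0 ≤ s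
  lt : s < r
  empty : ∀ p ∈ P, (|p.1 - cx| ≤ s ∧ |p.2 - cy| ≤ s) ∨ r ≤ |p.1 - cx| ∨ r ≤ |p.2 - cy|
  exists_in : ∃ p ∈ P, |p.1 - cx| ≤ s ∧ |p.2 - cy| ≤ s
  exists_out : ∃ p ∈ P, r ≤ |p.1 - cx| ∨ r ≤ |p.2 - cy|

theorem SquareAnnulus.emptyValid_iff (A : SquareAnnulus) (P : Set (ℝ × ℝ)) (h : 0 < A.width) :
    A.IsEmptyOf P ∧ A.IsValidFor P ↔
      IsCandidate P A.center.1 A.center.2 A.outerRadius A.innerRadius := by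
  have hlt : A.innerRadius < A.outerRadius := by
    simp only [SquareAnnulus.width] at h
    linarith
  have hE : A.IsEmptyOf P ↔ ∀ p ∈ P,
      (|p.1 - A.center.1| ≤ A.innerRadius ∧ |p.2 - A.center.2| ≤ A.innerRadius) ∨
        A.outerRadius ≤ |p.1 - A.center.1| ∨ A.outerRadius ≤ |p.2 - A.center.2| := by
    rw [SquareAnnulus.IsEmptyOf, A.interior_region, Set.disjoint_right]
    refine forall₂_congr fun p _ => ?_
    simp only [Set.mem_ofPred_eq, Prod.dist_eq, Real.dist_eq, not_and_or, not_lt, max_le_iff,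
      le_max_iff]
  have hin : ∀ p, p ∈ A.innerSquare ↔
      |p.1 - A.center.1| ≤ A.innerRadius ∧ |p.2 - A.center.2| ≤ A.innerRadius := fun p => Iff.rfl
  rw [hE]
  constructor
  · rintro ⟨he, ⟨q, hq, hq'⟩, p, hp, hp'⟩
    refine ⟨A.inner_nonneg, hlt, he, ⟨p, hp, hp'⟩, q, hq, ?_⟩
    refine (he q hq).resolve_left fun hi => hq' ⟨hq, hi⟩
  · rintro ⟨-, -, he, ⟨p, hp, hp'⟩, q, hq, hq'⟩
    refine ⟨he, ⟨q, hq, fun hi => ?_⟩, p, hp, hp'⟩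
    have hi' := (hin q).1 hi.2
    rcases hq' with hq' | hq' <;> linarith

theorem IsCandidate.swap {P : Set (ℝ × ℝ)} {cx cy r s : ℝ} (h : IsCandidate P cx cy r s) :
    IsCandidate (Prod.swap '' P) cy cx r s := by
  refine ⟨h.nonneg, h.lt, ?_, ?_, ?_⟩
  · rintro _ ⟨p, hp, rfl⟩
    exact (h.empty p hp).imp And.symm Or.symm
  · obtain ⟨p, hp, hp'⟩ := h.exists_in
    exact ⟨_, ⟨p, hp, rfl⟩, hp'.symm⟩
  · obtain ⟨p, hp, hp'⟩ := h.exists_out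
    exact ⟨_, ⟨p, hp, rfl⟩, hp'.symm⟩

/-- The square of side length `b - a` in the vertical strip `a < x < b` with center at height `t` is
the outer square of an annulus of width `w` that contains no point of the strip. -/
def StripFeasibleAt (P : Set (ℝ × ℝ)) (a b w t : ℝ) : Prop :=
  (∃ p ∈ P, a < p.1 ∧ p.1 < b ∧ |p.2 - t| ≤ (b - a) / 2 - w) ∧
    ∀ p ∈ P, a < p.1 → p.1 < b →
      (w ≤ p.1 - a ∧ w ≤ b - p.1 ∧ |p.2 - t| ≤ (b - a) / 2 - w) ∨ (b - a) / 2 ≤ |p.2 - t|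

/-- Feasibility for some strip each of whose sides passes through a point or is the sentinel,
not both being sentinels. -/
def Feasible (P : Set (ℝ × ℝ)) (M w : ℝ) : Prop :=
  ∃ a b, a < b ∧ (a = -M ∨ ∃ p ∈ P, p.1 = a) ∧ (b = M ∨ ∃ p ∈ P, p.1 = b) ∧
    ¬ (a = -M ∧ b = M) ∧ ∃ t, StripFeasibleAt P a b w t

theorem exists_stripFeasibleAt_of_rectangle {P : Set (ℝ × ℝ)} (hP : P.Finite) {a b c d w : ℝ}
    (hle : b - a ≤ d - c)
    (hne : ∃ p ∈ P, (a < p.1 ∧ p.1 < b) ∧ c < p.2 ∧ p.2 < d)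
    (hin : ∀ p ∈ P, a < p.1 → p.1 < b → c < p.2 → p.2 < d →
      w ≤ p.1 - a ∧ w ≤ b - p.1 ∧ w ≤ p.2 - c ∧ w ≤ d - p.2)
    (hpair : ∀ p ∈ P, ∀ q ∈ P, a < p.1 → p.1 < b → c < p.2 → p.2 < d →
      a < q.1 → q.1 < b → c < q.2 → q.2 < d → p.2 - q.2 + 2 * w ≤ b - a) :
    ∃ t, StripFeasibleAt P a b w t := by
  set S : Set (ℝ × ℝ) := {p ∈ P | (a < p.1 ∧ p.1 < b) ∧ c < p.2 ∧ p.2 < d} with hS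
  have hSf : S.Finite := hP.subset fun p hp => hp.1
  have hSne : S.Nonempty := by
    obtain ⟨p, hp, h⟩ := hne
    exact ⟨p, hp, h⟩
  obtain ⟨u, ⟨huP, ⟨hu1, hu2⟩, hu3, hu4⟩, humax⟩ := Set.exists_max_image S Prod.snd hSf hSne
  set r := (b - a) / 2 with hr
  have key : ∀ p ∈ P, a < p.1 → p.1 < b → c < p.2 → p.2 < d →
      |p.2 - max (c + r) (u.2 - r + w)| ≤ r - w := by
    intro p hp h1 h2 h3 h4
    have hm := hin p hp h1 h2 h3 h4
    have hmax := humax p ⟨hp, ⟨h1, h2⟩, h3, h4⟩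
    have hpu := hpair u huP p hp hu1 hu2 hu3 hu4 h1 h2 h3 h4
    rw [abs_le]
    constructor
    · have : max (c + r) (u.2 - r + w) ≤ p.2 + r - w := max_le (by linarith) (by linarith)
      linarith
    · have := le_max_right (c + r) (u.2 - r + w)
      linarith
  refine ⟨max (c + r) (u.2 - r + w), ⟨u, huP, hu1, hu2, key u huP hu1 hu2 hu3 hu4⟩, ?_⟩
  intro p hp h1 h2
  by_cases h3 : c < p.2
  · by_cases h4 : p.2 < d
    · have hm := hin p hp h1 h2 h3 h4
      exact Or.inl ⟨hm.1, hm.2.1, key p hp h1 h2 h3 h4⟩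
    · right
      have := (hin u huP hu1 hu2 hu3 hu4).2.2.2
      have : max (c + r) (u.2 - r + w) ≤ d - r := max_le (by linarith) (by linarith)
      rw [le_abs]
      left
      linarith
  · right
    have := le_max_left (c + r) (u.2 - r + w)
    rw [le_abs]
    right
    linarith

/-- The last of the values `f p` of the points with `Z p` that does not exceed `α`, or the sentinel. -/
theorem exists_lower_side {P : Set (ℝ × ℝ)} (hP : P.Finite) (f : ℝ × ℝ → ℝ) (Z : ℝ × ℝ → Prop)
    (α M : ℝ) :
    ∃ a, (a = -M ∨ ((∃ p ∈ P, f p = a) ∧ a ≤ α)) ∧ ∀ p ∈ P, Z p → a < f p → α < f p := by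
  by_cases hne : {p ∈ P | Z p ∧ f p ≤ α}.Nonempty
  · obtain ⟨u, ⟨huP, -, hu⟩, hmax⟩ :=
      Set.exists_max_image _ f (hP.subset fun p hp => hp.1) hne
    refine ⟨f u, Or.inr ⟨⟨u, huP, rfl⟩, hu⟩, fun p hp hZ hlt => ?_⟩
    by_contra! hle
    exact absurd (hmax p ⟨hp, hZ, hle⟩) (not_le.2 hlt)
  · refine ⟨-M, Or.inl rfl, fun p hp hZ _ => ?_⟩
    by_contra! hle
    exact hne ⟨p, hp, hZ, hle⟩

theorem exists_upper_side {P : Set (ℝ × ℝ)} (hP : P.Finite) (f : ℝ × ℝ → ℝ) (Z : ℝ × ℝ → Prop)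
    (β M : ℝ) :
    ∃ b, (b = M ∨ ((∃ p ∈ P, f p = b) ∧ β ≤ b)) ∧ ∀ p ∈ P, Z p → f p < b → f p < β := by
  obtain ⟨a, ha, h⟩ := exists_lower_side hP (fun p => -f p) Z (-β) M
  refine ⟨-a, ?_, fun p hp hZ hlt => ?_⟩
  · rcases ha with rfl | ⟨⟨p, hp, rfl⟩, hle⟩
    · simp
    · exact Or.inr ⟨⟨p, hp, by simp⟩, by linarith⟩
  · have := h p hp hZ (by linarith)
    linarith

theorem IsCandidate.feasible_or {P : Set (ℝ × ℝ)} (hP : P.Finite) {M cx cy r s : ℝ}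
    (hM : ∀ p ∈ P, 8 * |p.1| + 1 ≤ M ∧ 8 * |p.2| + 1 ≤ M) (h : IsCandidate P cx cy r s) :
    Feasible P M (r - s) ∨ Feasible (Prod.swap '' P) M (r - s) := by
  have hs := h.nonneg
  have hsr := h.lt
  have hPin : ∀ p ∈ P, cx - r < p.1 → p.1 < cx + r → cy - r < p.2 → p.2 < cy + r →
      |p.1 - cx| ≤ s ∧ |p.2 - cy| ≤ s := by
    intro p hp h1 h2 h3 h4
    refine (h.empty p hp).resolve_right ?_
    rintro (h' | h') <;> rw [le_abs] at h' <;> rcases h' with h' | h' <;> linarith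
  have hbd : ∀ p ∈ P, (-((M - 1) / 8) ≤ p.1 ∧ p.1 ≤ (M - 1) / 8) ∧
      -((M - 1) / 8) ≤ p.2 ∧ p.2 ≤ (M - 1) / 8 := by
    intro p hp
    have := hM p hp
    exact ⟨abs_le.1 (by linarith), abs_le.1 (by linarith)⟩
  obtain ⟨i, hi, hix, hiy⟩ := h.exists_in
  obtain ⟨o, ho, ho'⟩ := h.exists_out
  have hibd := hbd i hi
  have hobd := hbd o ho
  rw [abs_le] at hix hiy
  have hM1 : 1 ≤ M := by linarith
  have hw : r - s ≤ (M - 1) / 4 := by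
    rcases ho' with h' | h' <;> rw [le_abs] at h' <;> rcases h' with h' | h' <;> linarith
  obtain ⟨a, ha, ha'⟩ := exists_lower_side hP Prod.fst (fun p => cy - r < p.2 ∧ p.2 < cy + r)
    (cx - r) M
  obtain ⟨b, hb, hb'⟩ := exists_upper_side hP Prod.fst (fun p => cy - r < p.2 ∧ p.2 < cy + r)
    (cx + r) M
  obtain ⟨c, hc, hc'⟩ := exists_lower_side hP Prod.snd (fun p => a < p.1 ∧ p.1 < b)
    (cy - r) M
  obtain ⟨d, hd, hd'⟩ := exists_upper_side hP Prod.snd (fun p => a < p.1 ∧ p.1 < b)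
    (cy + r) M
  have hin : ∀ p ∈ P, a < p.1 → p.1 < b → c < p.2 → p.2 < d →
      |p.1 - cx| ≤ s ∧ |p.2 - cy| ≤ s := by
    intro p hp h1 h2 h3 h4
    have h3' := hc' p hp ⟨h1, h2⟩ h3
    have h4' := hd' p hp ⟨h1, h2⟩ h4
    exact hPin p hp (ha' p hp ⟨h3', h4'⟩ h1) (hb' p hp ⟨h3', h4'⟩ h2) h3' h4'
  have hA : (a = -M) ∨ (a ≤ cx - r ∧ -((M - 1) / 8) ≤ a ∧ a ≤ (M - 1) / 8) := by
    rcases ha with ha | ⟨⟨p, hp, rfl⟩, hle⟩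
    · exact Or.inl ha
    · exact Or.inr ⟨hle, (hbd p hp).1⟩
  have hB : (b = M) ∨ (cx + r ≤ b ∧ -((M - 1) / 8) ≤ b ∧ b ≤ (M - 1) / 8) := by
    rcases hb with hb | ⟨⟨p, hp, rfl⟩, hle⟩
    · exact Or.inl hb
    · exact Or.inr ⟨hle, (hbd p hp).1⟩
  have hC : (c = -M) ∨ (c ≤ cy - r ∧ -((M - 1) / 8) ≤ c ∧ c ≤ (M - 1) / 8) := by
    rcases hc with hc | ⟨⟨p, hp, rfl⟩, hle⟩
    · exact Or.inl hc
    · exact Or.inr ⟨hle, (hbd p hp).2⟩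
  have hD : (d = M) ∨ (cy + r ≤ d ∧ -((M - 1) / 8) ≤ d ∧ d ≤ (M - 1) / 8) := by
    rcases hd with hd | ⟨⟨p, hp, rfl⟩, hle⟩
    · exact Or.inl hd
    · exact Or.inr ⟨hle, (hbd p hp).2⟩
  have hmargin : ∀ p ∈ P, |p.1 - cx| ≤ s → |p.2 - cy| ≤ s →
      (r - s ≤ p.1 - a ∧ r - s ≤ b - p.1) ∧ r - s ≤ p.2 - c ∧ r - s ≤ d - p.2 := by
    intro p hp h1 h2
    have := hbd p hp
    rw [abs_le] at h1 h2
    refine ⟨⟨?_, ?_⟩, ?_, ?_⟩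
    · rcases hA with hA | hA <;> linarith
    · rcases hB with hB | hB <;> linarith
    · rcases hC with hC | hC <;> linarith
    · rcases hD with hD | hD <;> linarith
  have hpairx : ∀ p ∈ P, ∀ q ∈ P, |p.1 - cx| ≤ s → |q.1 - cx| ≤ s →
      p.1 - q.1 + 2 * (r - s) ≤ d - c := by
    intro p hp q hq h1 h2
    have := hbd p hp
    have := hbd q hq
    rw [abs_le] at h1 h2
    rcases hC with hC | hC <;> rcases hD with hD | hD <;> linarith
  have hpairy : ∀ p ∈ P, ∀ q ∈ P, |p.2 - cy| ≤ s → |q.2 - cy| ≤ s →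
      p.2 - q.2 + 2 * (r - s) ≤ b - a := by
    intro p hp q hq h1 h2
    have := hbd p hp
    have := hbd q hq
    rw [abs_le] at h1 h2
    rcases hA with hA | hA <;> rcases hB with hB | hB <;> linarith
  have him := hmargin i hi (abs_le.2 hix) (abs_le.2 hiy)
  have hnot : ¬ (a = -M ∧ b = M ∧ c = -M ∧ d = M) := by
    rintro ⟨rfl, rfl, rfl, rfl⟩
    have := hin o ho (by linarith) (by linarith) (by linarith) (by linarith)
    rcases ho' with h' | h' <;> linarith
  have haM : -M ≤ a := by rcases hA with hA | hA <;> linarith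
  have hbM : b ≤ M := by rcases hB with hB | hB <;> linarith
  have hcM : -M ≤ c := by rcases hC with hC | hC <;> linarith
  have hdM : d ≤ M := by rcases hD with hD | hD <;> linarith
  rcases le_total (b - a) (d - c) with hle | hle
  · left
    refine ⟨a, b, by linarith, ha.imp_right And.left, hb.imp_right And.left, ?_, ?_⟩
    · rintro ⟨h1, h2⟩
      exact hnot ⟨h1, h2, by linarith, by linarith⟩
    · refine exists_stripFeasibleAt_of_rectangle (c := c) (d := d) hP hle
        ⟨i, hi, ⟨by linarith, by linarith⟩, by linarith, by linarith⟩ ?_ ?_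
      · intro p hp h1 h2 h3 h4
        have := hin p hp h1 h2 h3 h4
        have := hmargin p hp this.1 this.2
        exact ⟨this.1.1, this.1.2, this.2.1, this.2.2⟩
      · intro p hp q hq h1 h2 h3 h4 h5 h6 h7 h8
        exact hpairy p hp q hq (hin p hp h1 h2 h3 h4).2 (hin q hq h5 h6 h7 h8).2
  · right
    have hex : ∀ x, (∃ p ∈ P, p.2 = x) → ∃ p ∈ Prod.swap '' P, p.1 = x := by
      rintro x ⟨p, hp, rfl⟩
      exact ⟨_, ⟨p, hp, rfl⟩, rfl⟩
    refine ⟨c, d, by linarith, hc.imp_right fun h => hex _ h.1, hd.imp_right fun h => hex _ h.1,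
      ?_, ?_⟩
    · rintro ⟨h1, h2⟩
      exact hnot ⟨by linarith, by linarith, h1, h2⟩
    · refine exists_stripFeasibleAt_of_rectangle (c := a) (d := b) (hP.image _) hle
        ⟨_, ⟨i, hi, rfl⟩, ⟨?_, ?_⟩, ?_, ?_⟩ ?_ ?_
      · simp only [Prod.fst_swap]; linarith
      · simp only [Prod.fst_swap]; linarith
      · simp only [Prod.snd_swap]; linarith
      · simp only [Prod.snd_swap]; linarith
      · rintro _ ⟨p, hp, rfl⟩ h1 h2 h3 h4
        have := hin p hp h3 h4 h1 h2
        have := hmargin p hp this.1 this.2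
        exact ⟨this.2.1, this.2.2, this.1.1, this.1.2⟩
      · rintro _ ⟨p, hp, rfl⟩ _ ⟨q, hq, rfl⟩ h1 h2 h3 h4 h5 h6 h7 h8
        exact hpairx p hp q hq (hin p hp h3 h4 h1 h2).1 (hin q hq h7 h8 h5 h6).1

/-- Two distinct points always leave room for an annulus around one of them. -/
theorem exists_isCandidate {P : Set (ℝ × ℝ)} (hP : P.Finite) {p q : ℝ × ℝ} (hp : p ∈ P)
    (hq : q ∈ P) (hpq : p ≠ q) : ∃ cx cy r s, IsCandidate P cx cy r s := by
  obtain ⟨u, ⟨huP, hup⟩, hmin⟩ := Set.exists_min_image {u ∈ P | u ≠ p} (fun u => dist u p)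
    (hP.subset fun u hu => hu.1) ⟨q, hq, hpq.symm⟩
  have hle : ∀ v ∈ P, v ≠ p → dist u p ≤ |v.1 - p.1| ∨ dist u p ≤ |v.2 - p.2| := by
    intro v hv hvp
    have := hmin v ⟨hv, hvp⟩
    have hvp : dist v p = max |v.1 - p.1| |v.2 - p.2| := Prod.dist_eq
    rwa [hvp, le_max_iff] at this
  refine ⟨p.1, p.2, dist u p, 0, le_rfl, dist_pos.2 hup, fun v hv => ?_, ⟨p, hp, by simp⟩,
    u, huP, hle u huP hup⟩
  by_cases hvp : v = p
  · left; simp [hvp]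
  · exact Or.inr (hle v hv hvp)

/-! ### Sweeping a strip -/

/-- The points of `P` in the strip `a < x < b`, sorted by height: the `l`-th of them (`1 ≤ l ≤ k`) has
height `u l` and distance `μ l` from the boundary of the strip; `∓ B` are sentinels. -/
structure IsStrip (P : Set (ℝ × ℝ)) (a b B : ℝ) (k : ℕ) (u μ : ℕ → ℝ) : Prop where
  bottom : u 0 = -B
  top : u (k + 1) = B
  wide : ∀ p ∈ P, -B ≤ p.2 - (b - a) ∧ p.2 + (b - a) ≤ B
  sorted : ∀ i j, i ≤ j → j ≤ k + 1 → u i ≤ u j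
  sound : ∀ l, 1 ≤ l → l ≤ k →
    ∃ p ∈ P, (a < p.1 ∧ p.1 < b) ∧ u l = p.2 ∧ μ l = min (p.1 - a) (b - p.1)
  complete : ∀ p ∈ P, a < p.1 → p.1 < b →
    ∃ l, 1 ≤ l ∧ l ≤ k ∧ u l = p.2 ∧ μ l = min (p.1 - a) (b - p.1)

/-- `x` is the minimum of `r` and of the `μ l` with `i ≤ l < j`. -/
def IsWindowMin (μ : ℕ → ℝ) (r : ℝ) (i j : ℕ) (x : ℝ) : Prop :=
  ∀ c, c ≤ x ↔ c ≤ r ∧ ∀ l, i ≤ l → l < j → c ≤ μ l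

namespace IsWindowMin

variable {μ : ℕ → ℝ} {r x y : ℝ} {i j s : ℕ}

theorem empty (μ : ℕ → ℝ) (r : ℝ) (i : ℕ) : IsWindowMin μ r i i r := fun c =>
  ⟨fun h => ⟨h, fun l h1 h2 => by omega⟩, fun h => h.1⟩

theorem snoc (h : IsWindowMin μ r i j x) (hij : i ≤ j) :
    IsWindowMin μ r i (j + 1) (min x (μ j)) := by
  intro c
  rw [le_min_iff, h c]
  constructor
  · rintro ⟨⟨h1, h2⟩, h3⟩
    refine ⟨h1, fun l hl hl' => ?_⟩
    rcases Nat.lt_succ_iff_lt_or_eq.1 hl' with h' | rfl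
    · exact h2 l hl h'
    · exact h3
  · rintro ⟨h1, h2⟩
    exact ⟨⟨h1, fun l hl hl' => h2 l hl (by omega)⟩, h2 j hij (by omega)⟩

theorem cons (h : IsWindowMin μ r (i + 1) j x) (hij : i < j) :
    IsWindowMin μ r i j (min x (μ i)) := by
  intro c
  rw [le_min_iff, h c]
  constructor
  · rintro ⟨⟨h1, h2⟩, h3⟩
    refine ⟨h1, fun l hl hl' => ?_⟩
    rcases Nat.eq_or_lt_of_le hl with rfl | h'
    · exact h3
    · exact h2 l h' hl'
  · rintro ⟨h1, h2⟩
    exact ⟨⟨h1, fun l hl hl' => h2 l (by omega) hl'⟩, h2 i le_rfl hij⟩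

theorem append (h : IsWindowMin μ r i s x) (h' : IsWindowMin μ r s j y) (his : i ≤ s)
    (hsj : s ≤ j) : IsWindowMin μ r i j (min y x) := by
  intro c
  rw [le_min_iff, h c, h' c]
  constructor
  · rintro ⟨⟨h1, h2⟩, -, h3⟩
    refine ⟨h1, fun l hl hl' => ?_⟩
    rcases lt_or_ge l s with h' | h'
    · exact h3 l hl h'
    · exact h2 l h' hl'
  · rintro ⟨h1, h2⟩
    exact ⟨⟨h1, fun l hl hl' => h2 l (by omega) hl'⟩, h1, fun l hl hl' => h2 l hl (by omega)⟩

end IsWindowMin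

namespace IsStrip

variable {P : Set (ℝ × ℝ)} {a b B : ℝ} {k : ℕ} {u μ : ℕ → ℝ} {i j : ℕ}

/-- The height of the center for the window `i ≤ l < j`. -/
noncomputable def height (u : ℕ → ℝ) (r : ℝ) (i j : ℕ) : ℝ :=
  min (max ((u i + u (j - 1)) * (1 / 2)) (u (i - 1) + r)) (u j - r)

/-- The width of the annulus for the window `i ≤ l < j` with smallest margin `x`. -/
noncomputable def value (u : ℕ → ℝ) (r x : ℝ) (i j : ℕ) : ℝ :=
  min (min x (height u r i j - u (j - 1) + r)) (u i + r - height u r i j)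

theorem le_value (h : IsStrip P a b B k u μ) {x w t : ℝ} (hi : 1 ≤ i) (hij : i < j)
    (hj : j ≤ k + 1) (hx : IsWindowMin μ ((b - a) / 2) i j x)
    (hf : StripFeasibleAt P a b w t)
    (h1 : u (i - 1) ≤ t - (b - a) / 2) (h2 : t - (b - a) / 2 < u i)
    (h3 : u (j - 1) < t + (b - a) / 2) (h4 : t + (b - a) / 2 ≤ u j) :
    w ≤ value u ((b - a) / 2) x i j := by
  have key : ∀ l, i ≤ l → l < j → w ≤ μ l ∧ |u l - t| ≤ (b - a) / 2 - w := by
    intro l hl hl'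
    obtain ⟨p, hp, ⟨hpa, hpb⟩, hu, hμ⟩ := h.sound l (by omega) (by omega)
    have hil := h.sorted i l hl (by omega)
    have hlj := h.sorted l (j - 1) (by omega) (by omega)
    rw [hμ, hu]
    rcases hf.2 p hp hpa hpb with hc | hc
    · exact ⟨le_min hc.1 hc.2.1, hc.2.2⟩
    · rw [le_abs, ← hu] at hc
      rcases hc with hc | hc <;> linarith
  have hki := (abs_le.1 (key i le_rfl hij).2)
  have hkj := (abs_le.1 (key (j - 1) (by omega) (by omega)).2)
  have hwx : w ≤ x := (hx w).2 ⟨by linarith, fun l hl hl' => (key l hl hl').1⟩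
  have hgap := h.sorted i (j - 1) (by omega) (by omega)
  refine le_min (le_min hwx ?_) ?_
  · have : u (j - 1) - (b - a) / 2 + w ≤ height u ((b - a) / 2) i j :=
      le_min (le_max_of_le_left (by linarith)) (by linarith)
    linarith
  · have : height u ((b - a) / 2) i j ≤ u i + (b - a) / 2 - w :=
      (min_le_left _ _).trans (max_le (by linarith) (by linarith))
    linarith

theorem isCandidate (h : IsStrip P a b B k u μ) {x : ℝ} (hi : 1 ≤ i) (hij : i < j)
    (hj : j ≤ k + 1) (hx : IsWindowMin μ ((b - a) / 2) i j x)
    (hside : ∃ p ∈ P, p.1 = a ∨ p.1 = b)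
    (hgap : u (i - 1) + 2 * ((b - a) / 2) ≤ u j) (hv : 0 < value u ((b - a) / 2) x i j) :
    IsCandidate P ((a + b) * (1 / 2)) (height u ((b - a) / 2) i j) ((b - a) / 2)
      ((b - a) / 2 - value u ((b - a) / 2) x i j) := by
  set w := value u ((b - a) / 2) x i j with hwdef
  set t := height u ((b - a) / 2) i j with htdef
  have hwx : w ≤ x := (min_le_left _ _).trans (min_le_left _ _)
  have hw1 : w ≤ t - u (j - 1) + (b - a) / 2 := (min_le_left _ _).trans (min_le_right _ _)
  have hw2 : w ≤ u i + (b - a) / 2 - t := min_le_right _ _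
  have ht1 : u (i - 1) + (b - a) / 2 ≤ t := le_min (le_max_right _ _) (by linarith)
  have ht2 : t ≤ u j - (b - a) / 2 := min_le_right _ _
  obtain ⟨hwr, hwμ⟩ := (hx w).1 hwx
  have key : ∀ l, i ≤ l → l < j → |u l - t| ≤ (b - a) / 2 - w := by
    intro l hl hl'
    have hil := h.sorted i l hl (by omega)
    have hlj := h.sorted l (j - 1) (by omega) (by omega)
    rw [abs_le]
    constructor <;> linarith
  have hmid : ∀ p : ℝ × ℝ, w ≤ min (p.1 - a) (b - p.1) →
      |p.1 - (a + b) * (1 / 2)| ≤ (b - a) / 2 - w := by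
    intro p hp
    rw [le_min_iff] at hp
    rw [abs_le]
    constructor <;> linarith
  refine ⟨by linarith, by linarith, ?_, ?_, ?_⟩
  · intro p hp
    rcases le_or_gt p.1 a with hpa | hpa
    · right; left
      rw [le_abs]
      right
      linarith
    rcases le_or_gt b p.1 with hpb | hpb
    · right; left
      rw [le_abs]
      left
      linarith
    obtain ⟨l, hl1, hlk, hu, hμ⟩ := h.complete p hp hpa hpb
    rcases lt_or_ge l i with hli | hli
    · right; right
      have := h.sorted l (i - 1) (by omega) (by omega)
      rw [← hu, le_abs]
      right
      linarith
    rcases lt_or_ge l j with hlj | hlj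
    · left
      exact ⟨hmid p (hμ ▸ hwμ l hli hlj), hu ▸ key l hli hlj⟩
    · right; right
      have := h.sorted j l hlj (by omega)
      rw [← hu, le_abs]
      left
      linarith
  · obtain ⟨p, hp, -, hu, hμ⟩ := h.sound i hi (by omega)
    exact ⟨p, hp, hmid p (hμ ▸ hwμ i le_rfl hij), hu ▸ key i le_rfl hij⟩
  · obtain ⟨p, hp, hpa⟩ := hside
    refine ⟨p, hp, Or.inl ?_⟩
    rw [le_abs]
    rcases hpa with hpa | hpa
    · right; linarith
    · left; linarith

/-- A square in the strip with a point inside is not passed completely by the window. -/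
theorem lt_of_feasible (h : IsStrip P a b B k u μ) {w t : ℝ} (hi : i ≤ k + 1)
    (hi1 : 1 ≤ i) (hw : 0 < w) (hf : StripFeasibleAt P a b w t)
    (h1 : u (i - 1) ≤ t - (b - a) / 2) (h4 : t + (b - a) / 2 ≤ u j) : i < j := by
  obtain ⟨⟨p, hp, hpa, hpb, hpt⟩, -⟩ := hf
  obtain ⟨l, hl1, hlk, hu, -⟩ := h.complete p hp hpa hpb
  rw [← hu, abs_le] at hpt
  by_contra! hji
  rcases lt_or_ge l i with hli | hli
  · have := h.sorted l (i - 1) (by omega) (by omega)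
    linarith
  · have := h.sorted j l (by omega) (by omega)
    linarith

end IsStrip

namespace RealRAM

/-! ### The sweep as a program

Word registers: `0` holds `n`; `1` and `2` hold the indices of the sides of the strip; `4` holds the number
`k` of points in the strip; `5`, `6` and `7` hold the ends of the window and the place where it is split.
Real registers: `0, …, 3` hold the best annulus so far and `4` its width; `5` holds the sentinel; `6`, `7`
and `8` hold the sides of the strip and half of their distance; `9` holds the window minimum behind the
split. Real arrays: `0` and `1` hold the points, `2` and `3` the heights and margins of the points of the
strip, and `4` the suffix minima of the window before the split. -/

/-- Append point number `reg 3` to the strip, if it lies there. -/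
def appendPoint : Program :=
  .cond (.conj (.realLt (.reg 6) (.get 0 (.reg 3))) (.realLt (.get 0 (.reg 3)) (.reg 7)))
    (.seq (.setWord 4 (.add (.reg 4) (.lit 1)))
    (.seq (.putReal 2 (.reg 4) (.get 1 (.reg 3)))
    (.seq (.setReal 12 (.sub (.get 0 (.reg 3)) (.reg 6)))
    (.seq (setMin 12 (.sub (.reg 7) (.get 0 (.reg 3))))
    (.putReal 3 (.reg 4) (.reg 12))))))
    .nop

def scanStrip : Program :=
  .seq (.setWord 4 (.lit 0))
  (.seq (.putReal 2 (.lit 0) (.mul (.lit (-4)) (.reg 5)))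
  (.seq (forLoop 3 (.reg 0) appendPoint)
  (.putReal 2 (.add (.reg 4) (.lit 1)) (.mul (.lit 4) (.reg 5)))))

/-- Store the annulus with center `((a + b) / 2, reg 10)` and width `reg 11` if it is wider. -/
def storeBest : Program :=
  .cond (.realLt (.reg 4) (.reg 11))
    (.seq (.setReal 0 (.mul (.add (.reg 6) (.reg 7)) (.lit (1 / 2))))
    (.seq (.setReal 1 (.reg 10))
    (.seq (.setReal 2 (.reg 8))
    (.seq (.setReal 3 (.sub (.reg 8) (.reg 11)))
    (.setReal 4 (.reg 11))))))
    .nop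

def evalWindow : Program :=
  .seq (.setReal 10 (.mul (.add (.get 2 (.reg 5)) (.get 2 (.sub (.reg 6) (.lit 1)))) (.lit (1 / 2))))
  (.seq (setMax 10 (.add (.get 2 (.sub (.reg 5) (.lit 1))) (.reg 8)))
  (.seq (setMin 10 (.sub (.get 2 (.reg 6)) (.reg 8)))
  (.seq (.setReal 11 (.reg 9))
  (.seq (setMin 11 (.get 4 (.reg 5)))
  (.seq (setMin 11 (.add (.sub (.reg 10) (.get 2 (.sub (.reg 6) (.lit 1)))) (.reg 8)))
  (.seq (setMin 11 (.sub (.add (.get 2 (.reg 5)) (.reg 8)) (.reg 10)))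
  storeBest))))))

/-- Move the split to the end of the window. -/
def rebuild : Program :=
  .seq (.setWord 7 (.reg 6))
  (.seq (.setReal 9 (.reg 8))
  (.seq (.putReal 4 (.reg 6) (.reg 8))
  (.seq (.setWord 8 (.reg 6))
  (.seq (.setReal 12 (.reg 8))
  (.loop (.wordLt (.reg 5) (.reg 8))
    (.seq (.setWord 8 (.sub (.reg 8) (.lit 1)))
    (.seq (setMin 12 (.get 3 (.reg 8)))
    (.putReal 4 (.reg 8) (.reg 12)))))))))

def moveWindow : Program :=
  .cond (.realLt (.get 2 (.reg 6)) (.add (.get 2 (.reg 5)) (.mul (.lit 2) (.reg 8))))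
    (.seq (setMin 9 (.get 3 (.reg 6))) (.setWord 6 (.add (.reg 6) (.lit 1))))
    (.seq (.cond (.wordLt (.reg 5) (.reg 7)) .nop rebuild)
      (.setWord 5 (.add (.reg 5) (.lit 1))))

def slideWindow : Program :=
  .seq (.setWord 5 (.lit 1))
  (.seq (.setWord 6 (.lit 1))
  (.seq (.setWord 7 (.lit 1))
  (.seq (.setReal 9 (.reg 8))
  (.seq (.putReal 4 (.lit 1) (.reg 8))
  (.loop (.wordLt (.reg 5) (.add (.reg 4) (.lit 1)))
    (.seq (.cond (.wordLt (.reg 5) (.reg 6)) evalWindow .nop) moveWindow))))))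

/-! ### Its specification -/

/-- The best annulus found so far is valid; the width zero stands for none. -/
structure BestValid (P : Set (ℝ × ℝ)) (m : Memory) : Prop where
  nonneg : 0 ≤ m.realReg 4
  valid : m.realReg 4 = 0 ∨
    IsCandidate P (m.realReg 0) (m.realReg 1) (m.realReg 2) (m.realReg 3) ∧
      m.realReg 2 - m.realReg 3 = m.realReg 4

/-- The parts of the memory that the sweep of the strip `a < x < b` leaves alone, and the best annulus. -/
structure SweepCtx (P : Set (ℝ × ℝ)) (X Y : ℕ → ℝ) (n i j : ℕ) (M a b w₀ : ℝ) (m : Memory) :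
    Prop where
  best : BestValid P m
  le_best : w₀ ≤ m.realReg 4
  size : m.wordReg 0 = n
  left : m.wordReg 1 = i
  right : m.wordReg 2 = j
  arrX : m.realArr 0 = X
  arrY : m.realArr 1 = Y
  sentinel : m.realReg 5 = M
  sideA : m.realReg 6 = a
  sideB : m.realReg 7 = b
  radius : m.realReg 8 = (b - a) / 2

namespace SweepCtx

variable {P : Set (ℝ × ℝ)} {X Y : ℕ → ℝ} {n i j : ℕ} {M a b w₀ : ℝ} {m : Memory}

theorem of_eq (h : SweepCtx P X Y n i j M a b w₀ m) {m' : Memory}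
    (hw : ∀ q < 3, m'.wordReg q = m.wordReg q) (hr : ∀ q < 9, m'.realReg q = m.realReg q)
    (ha : ∀ q < 2, m'.realArr q = m.realArr q) : SweepCtx P X Y n i j M a b w₀ m' := by
  obtain ⟨⟨h1, h2⟩, h3, h4, h5, h6, h7, h8, h9, h10, h11, h12⟩ := h
  have e0 := hr 0 (by norm_num)
  have e1 := hr 1 (by norm_num)
  have e2 := hr 2 (by norm_num)
  have e3 := hr 3 (by norm_num)
  have e4 := hr 4 (by norm_num)
  refine ⟨⟨by rwa [e4], by rwa [e0, e1, e2, e3, e4]⟩, by rwa [e4], ?_, ?_, ?_, ?_, ?_, ?_, ?_, ?_, ?_⟩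
  · rw [hw 0 (by norm_num), h4]
  · rw [hw 1 (by norm_num), h5]
  · rw [hw 2 (by norm_num), h6]
  · rw [ha 0 (by norm_num), h7]
  · rw [ha 1 (by norm_num), h8]
  · rw [hr 5 (by norm_num), h9]
  · rw [hr 6 (by norm_num), h10]
  · rw [hr 7 (by norm_num), h11]
  · rw [hr 8 (by norm_num), h12]

theorem setWord (h : SweepCtx P X Y n i j M a b w₀ m) {q : ℕ} (hq : 3 ≤ q) (v : ℕ) :
    SweepCtx P X Y n i j M a b w₀ (m.setWord q v) :=
  h.of_eq (fun l hl => Function.update_of_ne (by omega) _ _) (fun _ _ => rfl) (fun _ _ => rfl)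

theorem setReal (h : SweepCtx P X Y n i j M a b w₀ m) {q : ℕ} (hq : 9 ≤ q) (x : ℝ) :
    SweepCtx P X Y n i j M a b w₀ (m.setReal q x) :=
  h.of_eq (fun _ _ => rfl) (fun l hl => Function.update_of_ne (by omega) _ _) (fun _ _ => rfl)

theorem putReal (h : SweepCtx P X Y n i j M a b w₀ m) {q : ℕ} (hq : 2 ≤ q) (l : ℕ) (x : ℝ) :
    SweepCtx P X Y n i j M a b w₀ (m.putReal q l x) :=
  h.of_eq (fun _ _ => rfl) (fun _ _ => rfl) (fun l hl => Function.update_of_ne (by omega) _ _)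

end SweepCtx

/-- The state of the sweep, with the window `i' ≤ l < j'` split at `s`. -/
structure SweepInv (P : Set (ℝ × ℝ)) (X Y : ℕ → ℝ) (n i j : ℕ) (M a b w₀ : ℝ) (k : ℕ)
    (u μ : ℕ → ℝ) (m : Memory) : Prop where
  ctx : SweepCtx P X Y n i j M a b w₀ m
  count : m.wordReg 4 = k
  heights : m.realArr 2 = u
  margins : m.realArr 3 = μ
  one_le : 1 ≤ m.wordReg 5
  le_split : m.wordReg 5 ≤ m.wordReg 7
  split_le : m.wordReg 7 ≤ m.wordReg 6
  le_end : m.wordReg 6 ≤ k + 1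
  back : IsWindowMin μ ((b - a) / 2) (m.wordReg 7) (m.wordReg 6) (m.realReg 9)
  front : ∀ l, m.wordReg 5 ≤ l → l ≤ m.wordReg 7 →
    IsWindowMin μ ((b - a) / 2) l (m.wordReg 7) (m.realArr 4 l)
  gap : u (m.wordReg 5 - 1) + 2 * ((b - a) / 2) ≤ u (m.wordReg 6)
  opt : ∀ t w, 0 < w → StripFeasibleAt P a b w t → w ≤ m.realReg 4 ∨
    (u (m.wordReg 5 - 1) ≤ t - (b - a) / 2 ∧ u (m.wordReg 6 - 1) < t + (b - a) / 2)

section Specs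

variable {L : Limits} {P : Set (ℝ × ℝ)} {X Y : ℕ → ℝ} {n i j : ℕ} {M a b w₀ : ℝ} {k : ℕ}
  {u μ : ℕ → ℝ} {m : Memory}

theorem wp_storeBest (h : SweepCtx P X Y n i j M a b w₀ m)
    (hcand : m.realReg 4 < m.realReg 11 → IsCandidate P ((a + b) * (1 / 2)) (m.realReg 10)
      ((b - a) / 2) ((b - a) / 2 - m.realReg 11)) :
    WP L storeBest m fun t m' => t ≤ 30 ∧ SweepCtx P X Y n i j M a b w₀ m' ∧
      m.realReg 4 ≤ m'.realReg 4 ∧ m.realReg 11 ≤ m'.realReg 4 ∧ m'.realReg 9 = m.realReg 9 ∧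
      m'.wordReg = m.wordReg ∧ m'.realArr = m.realArr := by
  rw [storeBest, wp_cond]
  refine ⟨⟨trivial, trivial⟩, fun hlt => ?_, fun hlt => ?_⟩
  · simp only [Test.Holds, RealExp.val] at hlt
    simp only [wp_seq, wp_setReal, RealExp.Legal, RealExp.val, RealExp.cost, Test.cost,
      Memory.setReal_realReg, Memory.setReal_realArr, Memory.setReal_wordReg]
    have hc := hcand hlt
    obtain ⟨⟨h1, h2⟩, h3, h4, h5, h6, h7, h8, h9, h10, h11, h12⟩ := h
    have hq : (((1 / 2 : ℚ) : ℚ) : ℝ) = 1 / 2 := by norm_num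
    simp [h10, h11, h12, hlt.le]
    refine ⟨⟨?_, ?_⟩, ?_, ?_, ?_, ?_, ?_, ?_, ?_, ?_, ?_, ?_⟩ <;>
      simp_all
    · linarith
    · linarith
  · simp only [Test.Holds, RealExp.val, not_lt] at hlt
    rw [wp_nop]
    exact ⟨by simp [Test.cost, RealExp.cost], h, le_rfl, hlt, rfl, rfl, rfl⟩

theorem wp_evalWindow {B : ℝ} (hL : n + 10 < L.wordBound) (hC : n + 2 ≤ L.cells) (hk : k ≤ n)
    (hs : IsStrip P a b B k u μ) (hside : ∃ p ∈ P, p.1 = a ∨ p.1 = b)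
    (h : SweepInv P X Y n i j M a b w₀ k u μ m) (hlt : m.wordReg 5 < m.wordReg 6) :
    WP L evalWindow m fun t m' => t ≤ 200 ∧ SweepInv P X Y n i j M a b w₀ k u μ m' ∧
      (∀ t w, 0 < w → StripFeasibleAt P a b w t → w ≤ m'.realReg 4 ∨
        ¬ (t - (b - a) / 2 < u (m.wordReg 5) ∧ t + (b - a) / 2 ≤ u (m.wordReg 6))) ∧
      m'.wordReg = m.wordReg := by
  obtain ⟨hctx, hcount, hheights, hmargins, h1, h2, h3, h4, hback, hfront, hgap, hopt⟩ := h
  have hmin := (hfront _ le_rfl h2).append hback h2 h3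
  have hval := fun t w (hf : StripFeasibleAt P a b w t) => hs.le_value h1 hlt h4 hmin hf
  have hcand := hs.isCandidate h1 hlt h4 hmin hside hgap
  have hr := hctx.radius
  have store : ∀ m₁ : Memory, SweepCtx P X Y n i j M a b w₀ m₁ →
      m₁.realReg 10 = IsStrip.height u ((b - a) / 2) (m.wordReg 5) (m.wordReg 6) →
      m₁.realReg 11 = IsStrip.value u ((b - a) / 2)
        (min (m.realReg 9) (m.realArr 4 (m.wordReg 5))) (m.wordReg 5) (m.wordReg 6) →
      m₁.realReg 4 = m.realReg 4 → m₁.realReg 9 = m.realReg 9 → m₁.wordReg = m.wordReg →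
      m₁.realArr = m.realArr → ∀ s ≤ 120, WP L storeBest m₁ fun t m' => s + t ≤ 200 ∧
        SweepInv P X Y n i j M a b w₀ k u μ m' ∧
        (∀ t w, 0 < w → StripFeasibleAt P a b w t → w ≤ m'.realReg 4 ∨
          ¬ (t - (b - a) / 2 < u (m.wordReg 5) ∧ t + (b - a) / 2 ≤ u (m.wordReg 6))) ∧
        m'.wordReg = m.wordReg := by
    intro m₁ hctx₁ e10 e11 e4 e9 ew ea s hs'
    have hnn := hctx₁.best.nonneg
    refine (wp_storeBest hctx₁ fun hlt' => ?_).mono ?_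
    · rw [e11] at hlt'
      rw [e10, e11]
      exact hcand (by linarith)
    · rintro t m' ⟨ht, hctx', hge4, hge11, e9', ew', ea'⟩
      rw [e4] at hge4
      rw [e11] at hge11
      have ew'' := ew'.trans ew
      have ea'' := ea'.trans ea
      refine ⟨by omega, ⟨hctx', ?_, ?_, ?_, ?_, ?_, ?_, ?_, ?_, ?_, ?_, ?_⟩, ?_, ew''⟩
      · rwa [ew'']
      · rwa [ea'']
      · rwa [ea'']
      · rwa [ew'']
      · rwa [ew'']
      · rwa [ew'']
      · rwa [ew'']
      · rwa [ew'', e9', e9]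
      · rwa [ew'', ea'']
      · rwa [ew'']
      · rw [ew'']
        intro t w hw hf
        exact (hopt t w hw hf).imp_left fun h => h.trans hge4
      · intro t w hw hf
        by_cases hh : t - (b - a) / 2 < u (m.wordReg 5) ∧ t + (b - a) / 2 ≤ u (m.wordReg 6)
        · left
          rcases hopt t w hw hf with h | h
          · exact h.trans hge4
          · exact (hval t w hf h.1 hh.1 h.2 hh.2).trans hge11
        · exact Or.inr hh
  rw [evalWindow]
  simp only [wp_seq, wp_setReal]
  refine ⟨?_, wp_setMax ?_ fun t1 ht1 => wp_setMin ?_ fun t2 ht2 => ⟨trivial, wp_setMin ?_ fun t3 ht3 =>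
    wp_setMin ?_ fun t4 ht4 => wp_setMin ?_ fun t5 ht5 => ?_⟩⟩
  iterate 6
    simp [RealExp.Legal, WordExp.Legal, WordExp.val]
    try omega
  simp only [RealExp.cost, WordExp.cost] at *
  simp only [← add_assoc]
  refine store _ ?_ ?_ ?_ ?_ ?_ ?_ ?_ _ ?_
  · exact ((((((hctx.setReal (by norm_num) _).setReal (by norm_num) _).setReal
      (by norm_num) _).setReal (by norm_num) _).setReal (by norm_num) _).setReal
      (by norm_num) _).setReal (by norm_num) _
  on_goal 7 => omega
  all_goals
    simp [RealExp.val, WordExp.val, hheights, hr, IsStrip.value, IsStrip.height]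

theorem wp_rebuild (hL : n + 10 < L.wordBound) (hC : n + 2 ≤ L.cells) (hk : k ≤ n)
    (hctx : SweepCtx P X Y n i j M a b w₀ m) (hmargins : m.realArr 3 = μ)
    (hlt : m.wordReg 5 < m.wordReg 6) (hle : m.wordReg 6 ≤ k + 1) :
    WP L rebuild m fun t m' => t ≤ 30 * (m.wordReg 6 - m.wordReg 5) + 30 ∧
      SweepCtx P X Y n i j M a b w₀ m' ∧ m'.wordReg 4 = m.wordReg 4 ∧
      m'.wordReg 5 = m.wordReg 5 ∧ m'.wordReg 6 = m.wordReg 6 ∧ m'.wordReg 7 = m.wordReg 6 ∧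
      m'.realReg 4 = m.realReg 4 ∧ m'.realReg 9 = (b - a) / 2 ∧
      m'.realArr 2 = m.realArr 2 ∧ m'.realArr 3 = m.realArr 3 ∧
      ∀ l, m.wordReg 5 ≤ l → l ≤ m.wordReg 6 →
        IsWindowMin μ ((b - a) / 2) l (m.wordReg 6) (m'.realArr 4 l) := by
  rw [rebuild]
  simp only [wp_seq, wp_setReal, wp_setWord, wp_putReal, RealExp.Legal, WordExp.Legal,
    RealExp.val, WordExp.val, RealExp.cost, WordExp.cost]
  simp
  refine ⟨by omega, by omega, by omega, ?_⟩
  refine wp_loop (fun m' => SweepCtx P X Y n i j M a b w₀ m' ∧ m'.wordReg 4 = m.wordReg 4 ∧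
      m'.wordReg 5 = m.wordReg 5 ∧ m'.wordReg 6 = m.wordReg 6 ∧ m'.wordReg 7 = m.wordReg 6 ∧
      m.wordReg 5 ≤ m'.wordReg 8 ∧ m'.wordReg 8 ≤ m.wordReg 6 ∧
      m'.realReg 4 = m.realReg 4 ∧ m'.realReg 9 = (b - a) / 2 ∧
      m'.realArr 2 = m.realArr 2 ∧ m'.realArr 3 = m.realArr 3 ∧
      (IsWindowMin μ ((b - a) / 2) (m'.wordReg 8) (m.wordReg 6) (m'.realReg 12)) ∧
      ∀ l, m'.wordReg 8 ≤ l → l ≤ m.wordReg 6 →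
        IsWindowMin μ ((b - a) / 2) l (m.wordReg 6) (m'.realArr 4 l))
    (fun m' => 30 * (m'.wordReg 8 - m.wordReg 5)) ?_ ?_ ?_ ?_
  · refine ⟨?_, ?_⟩
    · exact ((((((hctx.setWord (by norm_num) _).setReal (by norm_num) _).putReal
        (by norm_num) _ _).setWord (by norm_num) _).setReal (by norm_num) _))
    · simp [hctx.radius, IsWindowMin.empty, hlt.le]
      intro l hl hl'
      obtain rfl := le_antisymm hl' hl
      simp [IsWindowMin.empty]
  · rintro m' ⟨h1, h2, h3, h4, h5, h6, h7, h8, h9, h10, h11, h12, h13⟩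
    simp only [Test.Legal, WordExp.Legal]
    omega
  · rintro m' ⟨h1, h2, h3, h4, h5, h6, h7, h8, h9, h10, h11, h12, h13⟩ hb
    simp only [Test.Holds, WordExp.val] at hb
    simp only [wp_seq, wp_setWord, wp_putReal, WordExp.Legal, WordExp.val, WordExp.cost]
    refine ⟨⟨by omega, by omega⟩, wp_setMin ?_ ?_⟩
    · simp [RealExp.Legal, WordExp.Legal, WordExp.val]
      omega
    · intro t ht
      simp [RealExp.cost, WordExp.cost, RealExp.Legal, RealExp.val, WordExp.val, Test.cost] at ht ⊢
      obtain ⟨v, hv⟩ : ∃ v, m'.wordReg 8 = v + 1 := ⟨m'.wordReg 8 - 1, by omega⟩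
      rw [hv] at h6 h7 h12 h13 hb ⊢
      simp only [Nat.add_sub_cancel]
      have hnew := h12.cons (i := v) (by omega)
      rw [← hmargins, ← h11] at hnew
      rw [hmargins] at h11
      rw [h11] at hnew ⊢
      refine ⟨by omega, ⟨?_, h2, h3, h4, h5, by omega, by omega, h8, h9, h10, by rw [hmargins], hnew, ?_⟩,
        by omega⟩
      · exact ((h1.setWord (by norm_num) _).setReal (by norm_num) _).putReal (by norm_num) _ _
      · intro l hl hl'
        rcases Nat.eq_or_lt_of_le (Nat.le_of_succ_le_succ hl) with rfl | hl
        · rwa [Function.update_self]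
        · rw [Function.update_of_ne (by omega)]
          exact h13 l hl hl'
  · rintro t m' ht ⟨h1, h2, h3, h4, h5, h6, h7, h8, h9, h10, h11, h12, h13⟩ hb
    simp [Test.Holds, WordExp.val, Test.cost, WordExp.cost] at hb ht
    have hv : m'.wordReg 8 = m.wordReg 5 := by omega
    rw [hv] at h13
    exact ⟨by omega, h1, h2, h3, h4, h5, h8, h9, h10, h11, h13⟩

theorem wp_moveWindow {B : ℝ} (hL : n + 10 < L.wordBound) (hC : n + 2 ≤ L.cells) (hk : k ≤ n)
    (hs : IsStrip P a b B k u μ)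
    (h : SweepInv P X Y n i j M a b w₀ k u μ m) (hend : m.wordReg 5 ≤ k)
    (hopt : ∀ t w, 0 < w → StripFeasibleAt P a b w t → w ≤ m.realReg 4 ∨
        ¬ (t - (b - a) / 2 < u (m.wordReg 5) ∧ t + (b - a) / 2 ≤ u (m.wordReg 6)))
    (hr : a < b) :
    WP L moveWindow m fun t m' => SweepInv P X Y n i j M a b w₀ k u μ m' ∧
      t + (300 * (k + 1 - m'.wordReg 5) + 300 * (k + 1 - m'.wordReg 6) + 30 * (k + 1 - m'.wordReg 7)) + 230
        ≤ 300 * (k + 1 - m.wordReg 5) + 300 * (k + 1 - m.wordReg 6) + 30 * (k + 1 - m.wordReg 7) ∧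
      m'.wordReg 5 ≤ k + 1 := by
  obtain ⟨hctx, hcount, hheights, hmargins, h1, h2, h3, h4, hback, hfront, hgap, hopt'⟩ := h
  have hrad := hctx.radius
  rw [moveWindow, wp_cond]
  refine ⟨?_, fun hb => ?_, fun hb => ?_⟩
  · simp [Test.Legal, RealExp.Legal, WordExp.Legal, WordExp.val]
    omega
  · simp [Test.Holds, RealExp.val, WordExp.val, hheights, hrad] at hb
    have hj : m.wordReg 6 ≤ k := by
      by_contra! hj
      have hj' : m.wordReg 6 = k + 1 := by omega
      obtain ⟨p, hp, -, hu, -⟩ := hs.sound _ h1 hend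
      have := (hs.wide p hp).2
      rw [hj', hs.top, hu] at hb
      linarith
    rw [wp_seq]
    refine wp_setMin ?_ fun t ht => ?_
    · simp [RealExp.Legal, WordExp.Legal, WordExp.val]
      omega
    rw [wp_setWord]
    simp [RealExp.val, RealExp.cost, WordExp.Legal, WordExp.val, WordExp.cost, Test.cost, hmargins] at ht ⊢
    refine ⟨by omega, ⟨?_, hcount, hheights, hmargins, h1, h2, ?_, ?_, ?_, hfront, ?_, ?_⟩, by omega,
      by omega⟩
    · exact (hctx.setReal (by norm_num) _).setWord (by norm_num) _
    · simp
      omega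
    · simp
      omega
    · simpa using hback.snoc h3
    · have := hs.sorted (m.wordReg 6) (m.wordReg 6 + 1) (by omega) (by omega)
      simp
      linarith
    · intro t w hw hf
      rcases hopt t w hw hf with h | h
      · exact Or.inl h
      rcases hopt' t w hw hf with h' | ⟨h', h''⟩
      · exact Or.inl h'
      refine Or.inr ⟨h', ?_⟩
      simp
      by_contra! hge
      exact h ⟨by linarith, hge⟩
  · simp [Test.Holds, RealExp.val, WordExp.val, hheights, hrad] at hb
    have hlt : m.wordReg 5 < m.wordReg 6 := by
      rcases Nat.eq_or_lt_of_le (h2.trans h3) with he | hlt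
      · rw [← he] at hb
        linarith
      · exact hlt
    have hnext : ∀ t w, 0 < w → StripFeasibleAt P a b w t → w ≤ m.realReg 4 ∨
        (u (m.wordReg 5) ≤ t - (b - a) / 2 ∧ u (m.wordReg 6 - 1) < t + (b - a) / 2) := by
      intro t w hw hf
      rcases hopt t w hw hf with h | h
      · exact Or.inl h
      rcases hopt' t w hw hf with h' | ⟨h', h''⟩
      · exact Or.inl h'
      refine Or.inr ⟨?_, h''⟩
      by_contra! hge
      exact h ⟨hge, by linarith⟩
    rw [wp_seq, wp_cond]
    refine ⟨⟨?_, ?_⟩, fun hb' => ?_, fun hb' => ?_⟩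
    · simp only [WordExp.Legal]
      omega
    · simp only [WordExp.Legal]
      omega
    · simp [Test.Holds, WordExp.val] at hb'
      simp [wp_nop, wp_setWord, RealExp.cost, WordExp.Legal, WordExp.val, WordExp.cost, Test.cost]
      refine ⟨by omega, ⟨hctx.setWord (by norm_num) _, hcount, hheights, hmargins, ?_, hb', h3, h4,
        hback, ?_, ?_, ?_⟩, by omega, by omega⟩
      · simp
      · intro l hl hl'
        simp at hl hl' ⊢
        exact hfront l (by omega) hl'
      · simp
        linarith
      · simpa using hnext
    · simp [Test.Holds, WordExp.val] at hb'
      refine (wp_rebuild hL hC hk hctx hmargins hlt h4).mono ?_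
      rintro t m' ⟨ht, hctx', e4, e5, e6, e7, er4, er9, ea2, ea3, hnew⟩
      have hs7 : m.wordReg 7 = m.wordReg 5 := by omega
      simp [wp_setWord, RealExp.cost, WordExp.Legal, WordExp.val, WordExp.cost, Test.cost, e5, e6, e7,
        hs7]
      refine ⟨by omega, ⟨hctx'.setWord (by norm_num) _, ?_, ?_, ?_, ?_, ?_, ?_, ?_, ?_, ?_, ?_, ?_⟩,
        by omega, by omega⟩
      all_goals simp [e4, e6, e7, ea2, ea3, er9, er4, IsWindowMin.empty]
      · exact hcount
      · exact hheights
      · exact hmargins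
      · omega
      · omega
      · intro l hl hl'
        exact hnew l (by omega) hl'
      · linarith
      · exact hnext

theorem wp_slideWindow {B : ℝ} (hL : n + 10 < L.wordBound) (hC : n + 2 ≤ L.cells) (hk : k ≤ n)
    (hs : IsStrip P a b B k u μ) (hside : ∃ p ∈ P, p.1 = a ∨ p.1 = b) (hab : a < b)
    (hctx : SweepCtx P X Y n i j M a b w₀ m) (hcount : m.wordReg 4 = k)
    (hheights : m.realArr 2 = u) (hmargins : m.realArr 3 = μ) :
    WP L slideWindow m fun t m' => t ≤ 630 * k + 50 ∧ SweepCtx P X Y n i j M a b w₀ m' ∧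
      ∀ t w, 0 < w → StripFeasibleAt P a b w t → w ≤ m'.realReg 4 := by
  have hrad := hctx.radius
  obtain ⟨q, hq, hq'⟩ := hside
  have hwq := hs.wide q hq
  have hu1 : u 0 + (b - a) ≤ u 1 := by
    rcases Nat.eq_zero_or_pos k with rfl | hk0
    · rw [hs.bottom, ← zero_add 1, hs.top]
      linarith
    · obtain ⟨p, hp, -, hu, -⟩ := hs.sound 1 le_rfl hk0
      have := hs.wide p hp
      rw [hs.bottom, hu]
      linarith
  rw [slideWindow]
  simp only [wp_seq, wp_setReal, wp_setWord, wp_putReal, RealExp.Legal, WordExp.Legal,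
    RealExp.val, WordExp.val, RealExp.cost, WordExp.cost]
  simp
  refine ⟨by omega, by omega, ?_⟩
  refine wp_loop (fun m' => SweepInv P X Y n i j M a b w₀ k u μ m' ∧ m'.wordReg 5 ≤ k + 1)
    (fun m' => 300 * (k + 1 - m'.wordReg 5) + 300 * (k + 1 - m'.wordReg 6) +
      30 * (k + 1 - m'.wordReg 7)) ?_ ?_ ?_ ?_
  · refine ⟨⟨?_, ?_, ?_, ?_, ?_, ?_, ?_, ?_, ?_, ?_, ?_, ?_⟩, ?_⟩
    · exact (((((hctx.setWord (by norm_num) _).setWord (by norm_num) _).setWord (by norm_num) _).setReal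
        (by norm_num) _).putReal (by norm_num) _ _)
    all_goals simp [hcount, hheights, hmargins, hrad, IsWindowMin.empty]
    · intro l hl hl'
      obtain rfl := le_antisymm hl' hl
      simp [IsWindowMin.empty]
    · linarith
    · rintro t w hw ⟨⟨p, hp, -, -, hpt⟩, -⟩
      right
      rw [abs_le] at hpt
      have := hs.wide p hp
      rw [hs.bottom]
      constructor <;> linarith
  · rintro m' ⟨h, h'⟩
    have := h.count
    simp [Test.Legal, WordExp.Legal, WordExp.val]
    omega
  · rintro m' ⟨h, h'⟩ hb
    have hcount' := h.count
    have hle := h.le_split.trans h.split_le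
    have hle' := h.le_end
    simp [Test.Holds, WordExp.val, hcount'] at hb
    rw [wp_seq, wp_cond]
    refine ⟨⟨?_, ?_⟩, fun hlt => ?_, fun hlt => ?_⟩
    · simp only [WordExp.Legal]
      omega
    · simp only [WordExp.Legal]
      omega
    · simp only [Test.Holds, WordExp.val] at hlt
      refine (wp_evalWindow hL hC hk hs ⟨q, hq, hq'⟩ h hlt).mono ?_
      rintro s m₁ ⟨hs1, hinv, hopt, ew⟩
      rw [← ew] at hopt hb
      refine (wp_moveWindow hL hC hk hs hinv (by omega) hopt hab).mono ?_
      rintro s' m₂ ⟨hinv', hpot, hend⟩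
      rw [ew] at hpot
      refine ⟨⟨hinv', hend⟩, ?_⟩
      simp only [Test.cost, WordExp.cost]
      omega
    · simp only [Test.Holds, WordExp.val] at hlt
      rw [wp_nop]
      refine (wp_moveWindow hL hC hk hs h (by omega) ?_ hab).mono ?_
      · intro t w hw hf
        refine (h.opt t w hw hf).imp_right fun h1 h2 => ?_
        exact hlt (hs.lt_of_feasible h' h.one_le hw hf h1.1 h2.2)
      rintro s' m₂ ⟨hinv', hpot, hend⟩
      refine ⟨⟨hinv', hend⟩, ?_⟩
      simp only [Test.cost, WordExp.cost]
      omega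
  · rintro t m' ht ⟨h, h'⟩ hb
    have hcount' := h.count
    simp [Test.Holds, WordExp.val, hcount'] at hb
    simp [Test.cost, WordExp.cost] at ht
    refine ⟨by omega, h.ctx, fun t w hw hf => ?_⟩
    rcases h.opt t w hw hf with hle | ⟨h1, h2⟩
    · exact hle
    obtain ⟨⟨p, hp, hpa, hpb, hpt⟩, -⟩ := hf
    obtain ⟨l, hl1, hlk, hu, -⟩ := hs.complete p hp hpa hpb
    have := hs.sorted l (m'.wordReg 5 - 1) (by omega) (by omega)
    rw [← hu, abs_le] at hpt
    linarith

end Specs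

end RealRAM

namespace RealRAM

/-! ### All strips -/

/-- The first `n` entries of `X` and `Y` are the coordinates of the points of `P`. -/
structure Represents (P : Set (ℝ × ℝ)) (n : ℕ) (X Y : ℕ → ℝ) : Prop where
  mem : ∀ i < n, (X i, Y i) ∈ P
  exists_index : ∀ p ∈ P, ∃ i < n, X i = p.1 ∧ Y i = p.2

/-- The content of the arrays `2` and `3` after `v` points have been examined. -/
structure ScanInv (X Y : ℕ → ℝ) (a b B : ℝ) (v k : ℕ) (u μ : ℕ → ℝ) : Prop where
  le : k ≤ v
  bottom : u 0 = -B
  sorted : ∀ i j, 1 ≤ i → i ≤ j → j ≤ k → u i ≤ u j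
  sound : ∀ l, 1 ≤ l → l ≤ k →
    ∃ q < v, (a < X q ∧ X q < b) ∧ u l = Y q ∧ μ l = min (X q - a) (b - X q)
  complete : ∀ q < v, a < X q → X q < b →
    ∃ l, 1 ≤ l ∧ l ≤ k ∧ u l = Y q ∧ μ l = min (X q - a) (b - X q)

namespace ScanInv

variable {X Y : ℕ → ℝ} {a b B : ℝ} {v k : ℕ} {u μ : ℕ → ℝ}

theorem skip (h : ScanInv X Y a b B v k u μ) (hv : ¬ (a < X v ∧ X v < b)) :
    ScanInv X Y a b B (v + 1) k u μ := by
  refine ⟨h.le.trans (Nat.le_succ v), h.bottom, h.sorted, fun l h1 h2 => ?_, fun q hq ha hb => ?_⟩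
  · obtain ⟨q, hq, h'⟩ := h.sound l h1 h2
    exact ⟨q, hq.trans (Nat.lt_succ_self v), h'⟩
  · rcases Nat.lt_succ_iff_lt_or_eq.1 hq with hq | rfl
    · exact h.complete q hq ha hb
    · exact absurd ⟨ha, hb⟩ hv

theorem append (h : ScanInv X Y a b B v k u μ) (hv : a < X v ∧ X v < b)
    (hY : ∀ q < v, Y q ≤ Y v) :
    ScanInv X Y a b B (v + 1) (k + 1) (Function.update u (k + 1) (Y v))
      (Function.update μ (k + 1) (min (X v - a) (b - X v))) := by
  refine ⟨Nat.succ_le_succ h.le, ?_, fun i j h1 hij hj => ?_, fun l h1 h2 => ?_,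
    fun q hq ha hb => ?_⟩
  · rw [Function.update_of_ne (by omega)]
    exact h.bottom
  · rcases Nat.eq_or_lt_of_le hj with rfl | hj
    · rw [Function.update_self]
      rcases Nat.eq_or_lt_of_le hij with rfl | hij
      · rw [Function.update_self]
      · rw [Function.update_of_ne (by omega)]
        obtain ⟨q, hq, -, hu, -⟩ := h.sound i h1 (by omega)
        rw [hu]
        exact hY q hq
    · rw [Function.update_of_ne (by omega), Function.update_of_ne (by omega)]
      exact h.sorted i j h1 hij (by omega)
  · rcases Nat.eq_or_lt_of_le h2 with rfl | h2
    · exact ⟨v, Nat.lt_succ_self v, hv, by simp, by simp⟩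
    · obtain ⟨q, hq, h'⟩ := h.sound l h1 (by omega)
      refine ⟨q, hq.trans (Nat.lt_succ_self v), ?_⟩
      rwa [Function.update_of_ne (by omega), Function.update_of_ne (by omega)]
  · rcases Nat.lt_succ_iff_lt_or_eq.1 hq with hq | rfl
    · obtain ⟨l, h1, h2, h'⟩ := h.complete q hq ha hb
      refine ⟨l, h1, by omega, ?_⟩
      rwa [Function.update_of_ne (by omega), Function.update_of_ne (by omega)]
    · exact ⟨k + 1, by omega, le_rfl, by simp, by simp⟩

theorem isStrip {P : Set (ℝ × ℝ)} {n : ℕ} (h : ScanInv X Y a b B n k u μ)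
    (hP : Represents P n X Y) (hwide : ∀ p ∈ P, -B ≤ p.2 - (b - a) ∧ p.2 + (b - a) ≤ B)
    (hab : a < b) (hB : 0 ≤ B) : IsStrip P a b B k (Function.update u (k + 1) B) μ := by
  have hold : ∀ l ≤ k, Function.update u (k + 1) B l = u l := fun l hl =>
    Function.update_of_ne (by omega) _ _
  have hsound : ∀ l, 1 ≤ l → l ≤ k →
    ∃ p ∈ P, (a < p.1 ∧ p.1 < b) ∧ u l = p.2 ∧ μ l = min (p.1 - a) (b - p.1) := by
    intro l h1 h2
    obtain ⟨q, hq, h'⟩ := h.sound l h1 h2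
    exact ⟨_, hP.mem q hq, h'⟩
  refine ⟨?_, by simp, hwide, fun i j hij hj => ?_, fun l h1 h2 => ?_, fun p hp ha hb => ?_⟩
  · rw [hold 0 (by omega), h.bottom]
  · rcases Nat.eq_or_lt_of_le hj with rfl | hj
    · rw [Function.update_self]
      rcases Nat.eq_or_lt_of_le hij with rfl | hij
      · rw [Function.update_self]
      rw [hold i (by omega)]
      rcases Nat.eq_zero_or_pos i with rfl | hi
      · rw [h.bottom]
        linarith
      · obtain ⟨p, hp, -, hu, -⟩ := hsound i hi (by omega)
        have := hwide p hp
        rw [hu]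
        linarith
    · rw [hold i (by omega), hold j (by omega)]
      rcases Nat.eq_zero_or_pos i with rfl | hi
      · rcases Nat.eq_zero_or_pos j with rfl | hj'
        · exact le_rfl
        obtain ⟨p, hp, -, hu, -⟩ := hsound j hj' (by omega)
        have := hwide p hp
        rw [hu, h.bottom]
        linarith
      · exact h.sorted i j hi hij (by omega)
  · rw [hold l h2]
    exact hsound l h1 h2
  · obtain ⟨q, hq, hx, hy⟩ := hP.exists_index p hp
    rw [← hx] at ha hb
    obtain ⟨l, h1, h2, h'⟩ := h.complete q hq ha hb
    rw [hx, hy] at h'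
    refine ⟨l, h1, h2, ?_⟩
    rwa [hold l h2]

end ScanInv

/-- Sweep the strip between the points (or sentinels) `reg 1` and `reg 2`. -/
def sweepPair : Program :=
  .cond (.conj
      (.neg (.conj (.neg (.wordLt (.reg 1) (.reg 0))) (.neg (.wordLt (.reg 2) (.reg 0)))))
      (.realLt (.get 0 (.reg 1)) (.get 0 (.reg 2))))
    (.seq (.setReal 6 (.get 0 (.reg 1)))
    (.seq (.setReal 7 (.get 0 (.reg 2)))
    (.seq (.setReal 8 (.mul (.sub (.reg 7) (.reg 6)) (.lit (1 / 2))))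
    (.seq scanStrip slideWindow))))
    .nop

def sweepAll : Program :=
  forLoop 1 (.add (.reg 0) (.lit 2)) (forLoop 2 (.add (.reg 0) (.lit 2)) sweepPair)

/-- The points, the sentinel, and the best annulus so far, of width at least `w₀`. -/
structure Ctx (P : Set (ℝ × ℝ)) (X Y : ℕ → ℝ) (n : ℕ) (M w₀ : ℝ) (m : Memory) : Prop where
  best : BestValid P m
  le_best : w₀ ≤ m.realReg 4
  size : m.wordReg 0 = n
  arrX : m.realArr 0 = X
  arrY : m.realArr 1 = Y
  sentinel : m.realReg 5 = M

theorem Ctx.setWord {P : Set (ℝ × ℝ)} {X Y : ℕ → ℝ} {n : ℕ} {M w₀ : ℝ} {m : Memory}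
    (h : Ctx P X Y n M w₀ m) {q : ℕ} (hq : q ≠ 0) (v : ℕ) : Ctx P X Y n M w₀ (m.setWord q v) :=
  ⟨⟨h.best.nonneg, h.best.valid⟩, h.le_best, (Function.update_of_ne hq.symm _ _).trans h.size, h.arrX,
    h.arrY, h.sentinel⟩

section Specs

variable {L : Limits} {P : Set (ℝ × ℝ)} {X Y : ℕ → ℝ} {n i j : ℕ} {M a b w₀ : ℝ} {m : Memory}

theorem wp_scanStrip (hL : n + 10 < L.wordBound) (hC : n + 2 ≤ L.cells)
    (hP : Represents P n X Y) (hY : ∀ q r, q ≤ r → r < n → Y q ≤ Y r)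
    (hwide : ∀ p ∈ P, -(4 * M) ≤ p.2 - (b - a) ∧ p.2 + (b - a) ≤ 4 * M)
    (hab : a < b) (hM : 0 ≤ M) (hctx : SweepCtx P X Y n i j M a b w₀ m) :
    WP L scanStrip m fun t m' => t ≤ 100 * n + 50 ∧ SweepCtx P X Y n i j M a b w₀ m' ∧
      m'.wordReg 4 ≤ n ∧ IsStrip P a b (4 * M) (m'.wordReg 4) (m'.realArr 2) (m'.realArr 3) := by
  rw [scanStrip]
  simp only [wp_seq, wp_setWord, wp_putReal, RealExp.Legal, WordExp.Legal,
    RealExp.val, WordExp.val, RealExp.cost, WordExp.cost]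
  refine ⟨by omega, ⟨by omega, by omega, by simp⟩, ?_⟩
  refine wp_forLoop n 70 (fun v m => SweepCtx P X Y n i j M a b w₀ m ∧
    ScanInv X Y a b (4 * M) v (m.wordReg 4) (m.realArr 2) (m.realArr 3)) (by omega) ?_ ?_ ?_ ?_
  · refine ⟨((hctx.setWord (by norm_num) _).putReal (by norm_num) _ _).setWord (by norm_num) _, ?_⟩
    refine ⟨by simp, by simp [hctx.sentinel], ?_, ?_, ?_⟩
    · intro i j h1 h2 h3
      simp at h3
      omega
    · intro l h1 h2
      simp at h2
      omega
    · intro q hq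
      omega
  · rintro v m hv ⟨h, -⟩
    have := h.size
    exact ⟨by simp only [WordExp.Legal]; omega, this⟩
  · rintro v m hv hm ⟨h, hscan⟩
    have hX := h.arrX
    have hYa := h.arrY
    have hA := h.sideA
    have hB := h.sideB
    have hle := hscan.le
    rw [appendPoint, wp_cond]
    refine ⟨?_, fun hb => ?_, fun hb => ?_⟩
    · simp [Test.Legal, RealExp.Legal, WordExp.Legal, WordExp.val, hm]
      omega
    · simp [Test.Holds, RealExp.val, WordExp.val, hX, hA, hB, hm] at hb
      simp only [wp_seq, wp_setWord, wp_putReal, wp_setReal]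
      refine ⟨?_, ⟨?_, ?_, ?_⟩, ?_, wp_setMin ?_ fun t ht => ⟨⟨?_, ?_, ?_⟩, ?_⟩⟩
      iterate 9
        simp [RealExp.Legal, WordExp.Legal, WordExp.val, hm]
        try omega
      simp [RealExp.cost, WordExp.cost] at ht
      simp [RealExp.cost, WordExp.cost, Test.cost, RealExp.val, WordExp.val, hm, hX, hYa, hA, hB]
      refine ⟨by omega, ?_, ?_⟩
      · exact (((((h.setWord (by norm_num) _).putReal (by norm_num) _ _).setReal (by norm_num) _).setReal
          (by norm_num) _).putReal (by norm_num) _ _).setWord (by norm_num) _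
      · exact hscan.append hb fun q hq => hY q v hq.le hv
    · simp [Test.Holds, RealExp.val, WordExp.val, hX, hA, hB, hm] at hb
      rw [wp_nop]
      refine ⟨by simp [Test.cost, RealExp.cost, WordExp.cost], hm, h.setWord (by norm_num) _, ?_⟩
      exact hscan.skip fun h' => absurd h'.2 (not_lt.2 (hb h'.1))
  · rintro t m' ht ⟨h, hscan⟩
    have hle := hscan.le
    simp [WordExp.cost] at ht
    refine ⟨⟨⟨by omega, by omega, by omega⟩, by omega, trivial, trivial⟩, ?_⟩
    simp only [Rat.cast_ofNat, h.sentinel]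
    refine ⟨by omega, h.putReal (by norm_num) _ _, hle, ?_⟩
    simpa using hscan.isStrip hP hwide hab (by linarith)

theorem wp_sweepPair (hL : n + 10 < L.wordBound) (hC : n + 2 ≤ L.cells)
    (hP : Represents P n X Y) (hY : ∀ q r, q ≤ r → r < n → Y q ≤ Y r)
    (hX : ∀ q < n + 2, |X q| ≤ M) (hPM : ∀ p ∈ P, |p.2| ≤ M)
    (hctx : Ctx P X Y n M w₀ m) (hi : m.wordReg 1 = i) (hj : m.wordReg 2 = j) (hin : i < n + 2)
    (hjn : j < n + 2) :
    WP L sweepPair m fun t m' => t ≤ 800 * n + 200 ∧ Ctx P X Y n M w₀ m' ∧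
      m.realReg 4 ≤ m'.realReg 4 ∧ m'.wordReg 1 = i ∧ m'.wordReg 2 = j ∧
      ((i < n ∨ j < n) → X i < X j → ∀ t w, 0 < w → StripFeasibleAt P (X i) (X j) w t →
        w ≤ m'.realReg 4) := by
  have hn := hctx.size
  have hXa := hctx.arrX
  rw [sweepPair, wp_cond]
  refine ⟨?_, fun hb => ?_, fun hb => ?_⟩
  · simp [Test.Legal, RealExp.Legal, WordExp.Legal, WordExp.val]
    omega
  · simp [Test.Holds, RealExp.val, WordExp.val, hn, hXa, hi, hj] at hb
    obtain ⟨hij, hlt⟩ := hb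
    have hXi := abs_le.1 (hX i hin)
    have hXj := abs_le.1 (hX j hjn)
    simp only [wp_seq, wp_setReal]
    refine ⟨?_, ?_, ?_, ?_⟩
    iterate 3
      simp [RealExp.Legal, WordExp.Legal, WordExp.val]
      try omega
    have hwide : ∀ p ∈ P, -(4 * M) ≤ p.2 - (X j - X i) ∧ p.2 + (X j - X i) ≤ 4 * M := by
      intro p hp
      have := abs_le.1 (hPM p hp)
      constructor <;> linarith
    have hside : ∃ p ∈ P, p.1 = X i ∨ p.1 = X j := by
      by_cases h : i < n
      · exact ⟨_, hP.mem i h, Or.inl rfl⟩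
      · exact ⟨_, hP.mem j (hij (not_lt.1 h)), Or.inr rfl⟩
    refine (wp_scanStrip (a := X i) (b := X j) (i := i) (j := j) (w₀ := m.realReg 4) hL hC hP hY hwide
      hlt (by linarith) ?_).mono ?_
    · refine ⟨⟨?_, ?_⟩, ?_, ?_, ?_, ?_, ?_, ?_, ?_, ?_, ?_, ?_⟩
      all_goals simp [RealExp.val, WordExp.val, hctx.size, hctx.arrX, hctx.arrY, hctx.sentinel, hi, hj,
        hctx.best.nonneg, div_eq_mul_inv]
      exact hctx.best.valid
    · rintro t m₁ ⟨ht, hctx₁, hk, hs⟩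
      refine (wp_slideWindow hL hC hk hs hside hlt hctx₁ rfl rfl rfl).mono ?_
      rintro t' m₂ ⟨ht', hctx₂, hopt⟩
      refine ⟨?_, ⟨hctx₂.best, hctx.le_best.trans hctx₂.le_best, hctx₂.size, hctx₂.arrX, hctx₂.arrY,
        hctx₂.sentinel⟩, hctx₂.le_best, hctx₂.left, hctx₂.right, fun _ _ => hopt⟩
      simp only [Test.cost, RealExp.cost, WordExp.cost]
      omega
  · simp [Test.Holds, RealExp.val, WordExp.val, hn, hXa, hi, hj] at hb
    rw [wp_nop]
    refine ⟨by simp [Test.cost, RealExp.cost, WordExp.cost], hctx, le_rfl, hi, hj,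
      fun h1 h2 => absurd h2 (not_lt.2 (hb fun h3 => h1.resolve_left (not_lt.2 h3)))⟩

theorem wp_sweepAll (hL : n + 10 < L.wordBound) (hC : n + 2 ≤ L.cells)
    (hP : Represents P n X Y) (hY : ∀ q r, q ≤ r → r < n → Y q ≤ Y r)
    (hX : ∀ q < n + 2, |X q| ≤ M) (hPM : ∀ p ∈ P, |p.2| ≤ M)
    (hctx : Ctx P X Y n M w₀ m) :
    WP L sweepAll m fun t m' => t ≤ 1000 * (n + 2) ^ 3 ∧ Ctx P X Y n M w₀ m' ∧
      ∀ i < n + 2, ∀ j < n + 2, (i < n ∨ j < n) → X i < X j →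
        ∀ t w, 0 < w → StripFeasibleAt P (X i) (X j) w t → w ≤ m'.realReg 4 := by
  rw [sweepAll]
  have hbound : ∀ v m, Ctx P X Y n M w₀ m → v ≤ n + 2 →
      (WordExp.add (.reg 0) (.lit 2)).Legal L m ∧ (WordExp.add (.reg 0) (.lit 2)).val m = n + 2 := by
    intro v m h hv
    simp [WordExp.Legal, WordExp.val, h.size]
    omega
  refine wp_forLoop (n + 2) ((n + 2) * (800 * n + 210) + 8) (fun v m => Ctx P X Y n M w₀ m ∧
    ∀ i < v, ∀ j < n + 2, (i < n ∨ j < n) → X i < X j →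
        ∀ t w, 0 < w → StripFeasibleAt P (X i) (X j) w t → w ≤ m.realReg 4) (by omega) ?_ ?_ ?_ ?_
  · exact ⟨hctx.setWord (by norm_num) _, fun i hi => by omega⟩
  · rintro v m hv ⟨h, -⟩
    exact hbound v m h hv
  · rintro i m hi hmi ⟨h, hdone⟩
    refine wp_forLoop (n + 2) (800 * n + 200) (fun v m' => Ctx P X Y n M w₀ m' ∧
      m.realReg 4 ≤ m'.realReg 4 ∧ m'.wordReg 1 = i ∧ ∀ j < v, (i < n ∨ j < n) → X i < X j →
        ∀ t w, 0 < w → StripFeasibleAt P (X i) (X j) w t → w ≤ m'.realReg 4) (by omega) ?_ ?_ ?_ ?_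
    · exact ⟨h.setWord (by norm_num) _, le_rfl, by simpa using hmi, fun j hj => by omega⟩
    · rintro v m hv ⟨h, -⟩
      exact hbound v m h hv
    · rintro j m' hj hmj ⟨h', hle, hmi', hdone'⟩
      refine (wp_sweepPair hL hC hP hY hX hPM h' hmi' hmj hi hj).mono ?_
      rintro t m₂ ⟨ht, h₂, hle₂, hmi₂, hmj₂, hopt⟩
      refine ⟨ht, hmj₂, h₂.setWord (by norm_num) _, hle.trans hle₂, by simpa using hmi₂,
        fun j' hj' => ?_⟩
      rcases Nat.lt_succ_iff_lt_or_eq.1 hj' with hj' | rfl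
      · intro h1 h2 t w hw hf
        exact (hdone' j' hj' h1 h2 t w hw hf).trans hle₂
      · exact hopt
    · rintro t m' ht ⟨h', hle, hmi', hdone'⟩
      refine ⟨?_, hmi', h'.setWord (by norm_num) _, fun i' hi' => ?_⟩
      · simp only [WordExp.cost] at ht
        have : 800 * n + 200 + (1 + 1 + 1) + 7 = 800 * n + 210 := by ring
        rw [this] at ht
        omega
      · rcases Nat.lt_succ_iff_lt_or_eq.1 hi' with hi' | rfl
        · intro j hj h1 h2 t w hw hf
          exact (hdone i' hi' j hj h1 h2 t w hw hf).trans hle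
        · exact hdone'
  · rintro t m' ht ⟨h, hdone⟩
    refine ⟨ht.trans ?_, h, hdone⟩
    simp only [WordExp.cost]
    nlinarith [Nat.zero_le (n ^ 3), Nat.zero_le (n ^ 2)]

end Specs

end RealRAM

namespace RealRAM

/-! ### Sorting, transposition, and the whole program -/

/-- Exchange the points `reg 1` and `reg 2`. -/
def exchange : Program :=
  .seq (.setReal 12 (.get 0 (.reg 1)))
  (.seq (.putReal 0 (.reg 1) (.get 0 (.reg 2)))
  (.seq (.putReal 0 (.reg 2) (.reg 12))
  (.seq (.setReal 12 (.get 1 (.reg 1)))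
  (.seq (.putReal 1 (.reg 1) (.get 1 (.reg 2)))
  (.putReal 1 (.reg 2) (.reg 12))))))

/-- Sort the points by height. -/
def exchangeSort : Program :=
  forLoop 1 (.reg 0) (forLoop 2 (.reg 0)
    (.cond (.conj (.wordLt (.reg 1) (.reg 2)) (.realLt (.get 1 (.reg 2)) (.get 1 (.reg 1))))
      exchange .nop))

def putSentinels : Program :=
  .seq (.putReal 0 (.reg 0) (.sub (.lit 0) (.reg 5)))
    (.putReal 0 (.add (.reg 0) (.lit 1)) (.reg 5))

/-- Exchange the two coordinates of all points and of the best annulus. -/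
def transpose : Program :=
  .seq (forLoop 1 (.reg 0)
    (.seq (.setReal 12 (.get 0 (.reg 1)))
    (.seq (.putReal 0 (.reg 1) (.get 1 (.reg 1)))
    (.putReal 1 (.reg 1) (.reg 12)))))
  (.seq (.setReal 12 (.reg 0))
  (.seq (.setReal 0 (.reg 1))
  (.setReal 1 (.reg 12))))

def searchStrips : Program :=
  .seq exchangeSort (.seq putSentinels (.seq sweepAll transpose))

/-- The sentinel: a bound for the coordinates. -/
def computeSentinel : Program :=
  forLoop 1 (.reg 0)
    (.setReal 5 (.add (.reg 5)
      (.add (.mul (.lit 4) (.mul (.get 0 (.reg 1)) (.get 0 (.reg 1))))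
      (.add (.mul (.lit 4) (.mul (.get 1 (.reg 1)) (.get 1 (.reg 1)))) (.lit 5)))))

def maxWidthAnnulus : Program :=
  .seq computeSentinel (.seq searchStrips searchStrips)

theorem Represents.comp_swap {P : Set (ℝ × ℝ)} {n : ℕ} {X Y : ℕ → ℝ} (h : Represents P n X Y)
    {i j : ℕ} (hi : i < n) (hj : j < n) :
    Represents P n (X ∘ Equiv.swap i j) (Y ∘ Equiv.swap i j) := by
  have hlt : ∀ q < n, Equiv.swap i j q < n := by
    intro q hq
    rw [Equiv.swap_apply_def]
    split_ifs <;> assumption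
  refine ⟨fun q hq => h.mem _ (hlt q hq), fun p hp => ?_⟩
  obtain ⟨q, hq, hX, hY⟩ := h.exists_index p hp
  exact ⟨Equiv.swap i j q, hlt q hq, by simpa using hX, by simpa using hY⟩

theorem Represents.congr {P : Set (ℝ × ℝ)} {n : ℕ} {X Y X' Y' : ℕ → ℝ} (h : Represents P n X Y)
    (hX : ∀ q < n, X' q = X q) (hY : ∀ q < n, Y' q = Y q) : Represents P n X' Y' := by
  refine ⟨fun q hq => ?_, fun p hp => ?_⟩
  · rw [hX q hq, hY q hq]
    exact h.mem q hq
  · obtain ⟨q, hq, h1, h2⟩ := h.exists_index p hp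
    exact ⟨q, hq, (hX q hq).trans h1, (hY q hq).trans h2⟩

theorem Represents.transpose {P : Set (ℝ × ℝ)} {n : ℕ} {X Y : ℕ → ℝ} (h : Represents P n X Y) :
    Represents (Prod.swap '' P) n Y X := by
  refine ⟨fun q hq => ⟨_, h.mem q hq, rfl⟩, ?_⟩
  rintro _ ⟨p, hp, rfl⟩
  obtain ⟨q, hq, h1, h2⟩ := h.exists_index p hp
  exact ⟨q, hq, h2, h1⟩

section Specs

variable {L : Limits} {P : Set (ℝ × ℝ)} {X Y : ℕ → ℝ} {n i j : ℕ} {M w₀ : ℝ} {m : Memory}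

theorem wp_exchange (hL : n + 10 < L.wordBound) (hC : n + 2 ≤ L.cells)
    (hctx : Ctx P X Y n M w₀ m) (hi : m.wordReg 1 = i) (hj : m.wordReg 2 = j) (hin : i < n)
    (hjn : j < n) :
    WP L exchange m fun t m' => t ≤ 30 ∧
      Ctx P (X ∘ Equiv.swap i j) (Y ∘ Equiv.swap i j) n M w₀ m' ∧ m'.wordReg = m.wordReg := by
  rw [exchange]
  simp only [wp_seq, wp_putReal, wp_setReal, RealExp.Legal, WordExp.Legal, RealExp.val, WordExp.val,
    RealExp.cost, WordExp.cost]
  have h1 : i < L.wordBound := by omega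
  have h2 : i < L.cells := by omega
  have h3 : j < L.wordBound := by omega
  have h4 : j < L.cells := by omega
  simp [hi, hj, hctx.arrX, hctx.arrY, h1, h2, h3, h4]
  refine ⟨⟨hctx.best.nonneg, hctx.best.valid⟩, hctx.le_best, hctx.size, ?_, ?_, hctx.sentinel⟩
  all_goals
    rw [Equiv.swap_comm, Equiv.comp_swap_eq_update]
    simp [hctx.arrX, hctx.arrY]

theorem wp_exchangeSort (hL : n + 10 < L.wordBound) (hC : n + 2 ≤ L.cells)
    (hP : Represents P n X Y) (hctx : Ctx P X Y n M w₀ m) :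
    WP L exchangeSort m fun t m' => t ≤ 100 * (n + 2) ^ 2 ∧ ∃ X' Y', Ctx P X' Y' n M w₀ m' ∧
      Represents P n X' Y' ∧ ∀ q r, q ≤ r → r < n → Y' q ≤ Y' r := by
  rw [exchangeSort]
  have hbound : ∀ X Y m, Ctx P X Y n M w₀ m →
      (WordExp.reg 0).Legal L m ∧ (WordExp.reg 0).val m = n := by
    intro X Y m h
    simp [WordExp.Legal, WordExp.val, h.size]
    omega
  refine wp_forLoop n (n * 60 + 10) (fun v m => ∃ X Y, Ctx P X Y n M w₀ m ∧ Represents P n X Y ∧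
    ∀ q < v, ∀ r, q ≤ r → r < n → Y q ≤ Y r) (by omega) ?_ ?_ ?_ ?_
  · exact ⟨X, Y, hctx.setWord (by norm_num) _, hP, fun q hq => by omega⟩
  · rintro v m hv ⟨X, Y, h, -⟩
    exact hbound X Y m h
  · rintro i m hi hmi ⟨X, Y, h, hP, hsorted⟩
    refine wp_forLoop n 50 (fun v m => m.wordReg 1 = i ∧ ∃ X Y, Ctx P X Y n M w₀ m ∧
      Represents P n X Y ∧ (∀ q < i, ∀ r, q ≤ r → r < n → Y q ≤ Y r) ∧
      ∀ r, i ≤ r → r < v → Y i ≤ Y r) (by omega) ?_ ?_ ?_ ?_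
    · exact ⟨by simpa using hmi, X, Y, h.setWord (by norm_num) _, hP, hsorted, fun r h1 h2 => by omega⟩
    · rintro v m hv ⟨-, X, Y, h, -⟩
      exact hbound X Y m h
    · rintro j m hj hmj ⟨hmi, X, Y, h, hP, hsorted, hmin⟩
      have hYa := h.arrY
      rw [wp_cond]
      refine ⟨?_, fun hb => ?_, fun hb => ?_⟩
      · simp [Test.Legal, RealExp.Legal, WordExp.Legal, WordExp.val, hmi, hmj]
        omega
      · simp [Test.Holds, RealExp.val, WordExp.val, hYa, hmi, hmj] at hb
        obtain ⟨hij, hlt⟩ := hb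
        refine (wp_exchange hL hC h hmi hmj hi hj).mono ?_
        rintro t m' ⟨ht, h', ew⟩
        refine ⟨?_, by rw [ew, hmj], by simp [ew, hmi], _, _, h'.setWord (by norm_num) _,
          hP.comp_swap hi hj, ?_, ?_⟩
        · simp only [Test.cost, RealExp.cost, WordExp.cost]
          omega
        · intro q hq r hqr hr
          have e1 : Equiv.swap i j q = q := Equiv.swap_apply_of_ne_of_ne (by omega) (by omega)
          simp only [Function.comp_apply, e1]
          refine hsorted q hq _ ?_ ?_ <;> rw [Equiv.swap_apply_def] <;> split_ifs <;> omega
        · intro r hir hr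
          simp only [Function.comp_apply, Equiv.swap_apply_left]
          rcases Nat.lt_succ_iff_lt_or_eq.1 hr with hr | rfl
          · rcases Nat.eq_or_lt_of_le hir with rfl | hir'
            · simp
            · rw [Equiv.swap_apply_of_ne_of_ne (by omega) (by omega)]
              exact hlt.le.trans (hmin r hir hr)
          · simpa using hlt.le
      · simp [Test.Holds, RealExp.val, WordExp.val, hYa, hmi, hmj] at hb
        rw [wp_nop]
        refine ⟨by simp [Test.cost, RealExp.cost, WordExp.cost], hmj, by simpa using hmi, X, Y,
          h.setWord (by norm_num) _, hP, hsorted, fun r hir hr => ?_⟩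
        rcases Nat.lt_succ_iff_lt_or_eq.1 hr with hr | rfl
        · exact hmin r hir hr
        · rcases Nat.eq_or_lt_of_le hir with rfl | hir'
          · exact le_rfl
          · exact hb hir'
    · rintro t m ht ⟨hmi, X, Y, h, hP, hsorted, hmin⟩
      refine ⟨?_, hmi, X, Y, h.setWord (by norm_num) _, hP, fun q hq r hqr hr => ?_⟩
      · simp only [WordExp.cost] at ht
        omega
      · rcases Nat.lt_succ_iff_lt_or_eq.1 hq with hq | rfl
        · exact hsorted q hq r hqr hr
        · exact hmin r hqr hr
  · rintro t m ht ⟨X, Y, h, hP, hsorted⟩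
    refine ⟨ht.trans ?_, X, Y, h, hP, fun q r hqr hr => hsorted q (by omega) r hqr hr⟩
    simp only [WordExp.cost]
    nlinarith

theorem wp_putSentinels (hL : n + 10 < L.wordBound) (hC : n + 2 ≤ L.cells)
    (hctx : Ctx P X Y n M w₀ m) :
    WP L putSentinels m fun t m' => t ≤ 20 ∧
      Ctx P (Function.update (Function.update X n (-M)) (n + 1) M) Y n M w₀ m' := by
  rw [putSentinels]
  simp only [wp_seq, wp_putReal, RealExp.Legal, WordExp.Legal, RealExp.val, WordExp.val,
    RealExp.cost, WordExp.cost]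
  simp [hctx.size, hctx.sentinel]
  exact ⟨by omega, by omega, ⟨⟨hctx.best.nonneg, hctx.best.valid⟩, hctx.le_best, hctx.size,
    by simp [hctx.arrX], by simpa using hctx.arrY, hctx.sentinel⟩⟩

theorem wp_transpose (hL : n + 10 < L.wordBound) (hC : n + 2 ≤ L.cells)
    (hP : Represents P n X Y) (hctx : Ctx P X Y n M w₀ m) :
    WP L transpose m fun t m' => t ≤ 40 * (n + 2) ∧ ∃ X' Y',
      Ctx (Prod.swap '' P) X' Y' n M w₀ m' ∧ Represents (Prod.swap '' P) n X' Y' ∧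
      m'.realReg 4 = m.realReg 4 := by
  rw [transpose, wp_seq]
  refine wp_forLoop n 20 (fun v m' => ∃ X' Y', Ctx P X' Y' n M w₀ m' ∧
    (∀ q < v, X' q = Y q ∧ Y' q = X q) ∧ (∀ q, v ≤ q → X' q = X q ∧ Y' q = Y q) ∧
    m'.realReg 4 = m.realReg 4) (by omega) ?_ ?_ ?_ ?_
  · exact ⟨X, Y, hctx.setWord (by norm_num) _, fun q hq => by omega, fun q hq => ⟨rfl, rfl⟩, rfl⟩
  · rintro v m' hv ⟨X', Y', h, -⟩
    have := h.size
    simp only [WordExp.Legal, WordExp.val]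
    omega
  · rintro v m' hv hmv ⟨X', Y', h, hold, hnew, e4⟩
    simp only [wp_seq, wp_putReal, wp_setReal, RealExp.Legal, WordExp.Legal, RealExp.val, WordExp.val,
      RealExp.cost, WordExp.cost]
    have h1 : v < L.wordBound := by omega
    have h2 : v < L.cells := by omega
    simp [hmv, h.arrX, h.arrY, e4, h1, h2]
    refine ⟨Function.update X' v (Y' v), Function.update Y' v (X' v),
      ⟨⟨h.best.nonneg, h.best.valid⟩, h.le_best, h.size, by simp [h.arrX],
        by simp [h.arrY], h.sentinel⟩, ?_, ?_⟩
    · intro q hq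
      rcases Nat.lt_or_eq_of_le hq with hq | rfl
      · rw [Function.update_of_ne hq.ne, Function.update_of_ne hq.ne]
        exact hold q hq
      · have := hnew q le_rfl
        simp [this]
    · intro q hq
      rw [Function.update_of_ne (by omega), Function.update_of_ne (by omega)]
      exact hnew q (by omega)
  · rintro t m' ht ⟨X', Y', h, hold, -, e4⟩
    simp only [WordExp.cost] at ht
    simp only [wp_seq, wp_setReal, RealExp.Legal, RealExp.val, RealExp.cost]
    refine ⟨trivial, trivial, trivial, by omega, X', Y', ⟨⟨?_, ?_⟩, ?_, h.size, h.arrX, h.arrY, ?_⟩,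
      hP.transpose.congr (fun q hq => (hold q hq).1) (fun q hq => (hold q hq).2), ?_⟩
    all_goals simp
    · exact h.best.nonneg
    · exact h.best.valid.imp_right fun h => ⟨h.1.swap, h.2⟩
    · exact h.le_best
    · exact h.sentinel
    · exact e4

theorem wp_searchStrips (hL : n + 10 < L.wordBound) (hC : n + 2 ≤ L.cells)
    (hP : Represents P n X Y) (hM : 0 ≤ M) (hPM : ∀ p ∈ P, |p.1| ≤ M ∧ |p.2| ≤ M)
    (hctx : Ctx P X Y n M w₀ m) :
    WP L searchStrips m fun t m' => t ≤ 2000 * (n + 2) ^ 3 ∧ ∃ X' Y',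
      Ctx (Prod.swap '' P) X' Y' n M w₀ m' ∧ Represents (Prod.swap '' P) n X' Y' ∧
      ∀ w, 0 < w → Feasible P M w → w ≤ m'.realReg 4 := by
  simp only [searchStrips, wp_seq]
  refine (wp_exchangeSort hL hC hP hctx).mono ?_
  rintro t₁ m₁ ⟨ht₁, X₁, Y₁, hctx₁, hP₁, hsorted⟩
  refine (wp_putSentinels hL hC hctx₁).mono ?_
  rintro t₂ m₂ ⟨ht₂, hctx₂⟩
  set X₂ := Function.update (Function.update X₁ n (-M)) (n + 1) M with hX₂
  have hold : ∀ q < n, X₂ q = X₁ q := by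
    intro q hq
    rw [hX₂, Function.update_of_ne (by omega), Function.update_of_ne (by omega)]
  have hlow : X₂ n = -M := by
    rw [hX₂, Function.update_of_ne (by omega), Function.update_self]
  have hhigh : X₂ (n + 1) = M := Function.update_self _ _ _
  have hP₂ : Represents P n X₂ Y₁ := hP₁.congr hold fun _ _ => rfl
  have hbd : ∀ q < n + 2, |X₂ q| ≤ M := by
    intro q hq
    rcases lt_or_ge q n with hq' | hq'
    · exact (hPM _ (hP₂.mem q hq')).1
    rcases Nat.eq_or_lt_of_le hq' with rfl | hq''
    · rw [hlow, abs_neg, abs_of_nonneg hM]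
    · obtain rfl : q = n + 1 := by omega
      rw [hhigh, abs_of_nonneg hM]
  refine (wp_sweepAll hL hC hP₂ hsorted hbd (fun p hp => (hPM p hp).2) hctx₂).mono ?_
  rintro t₃ m₃ ⟨ht₃, hctx₃, hopt⟩
  refine (wp_transpose hL hC hP₂ hctx₃).mono ?_
  rintro t₄ m₄ ⟨ht₄, X₄, Y₄, hctx₄, hP₄, e4⟩
  refine ⟨?_, X₄, Y₄, hctx₄, hP₄, ?_⟩
  · have : 4 * (n + 2) ^ 2 ≤ 2 * (n + 2) ^ 3 := by
      rw [pow_succ _ 2]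
      nlinarith [Nat.zero_le ((n + 2) ^ 2)]
    have : 2 * (n + 2) ≤ (n + 2) ^ 2 := by nlinarith
    omega
  · rintro w hw ⟨a, b, hab, ha, hb, hnot, t, hf⟩
    rw [e4]
    obtain ⟨i, hi, rfl, hi'⟩ : ∃ i < n + 2, X₂ i = a ∧ (i < n ∨ a = -M) := by
      rcases ha with rfl | ⟨p, hp, rfl⟩
      · exact ⟨n, by omega, hlow, Or.inr rfl⟩
      · obtain ⟨i, hi, h1, -⟩ := hP₂.exists_index p hp
        exact ⟨i, by omega, h1, Or.inl hi⟩
    obtain ⟨j, hj, rfl, hj'⟩ : ∃ j < n + 2, X₂ j = b ∧ (j < n ∨ b = M) := by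
      rcases hb with rfl | ⟨p, hp, rfl⟩
      · exact ⟨n + 1, by omega, hhigh, Or.inr rfl⟩
      · obtain ⟨j, hj, h1, -⟩ := hP₂.exists_index p hp
        exact ⟨j, by omega, h1, Or.inl hj⟩
    refine hopt i hi j hj ?_ hab t w hw hf
    rcases hi' with hi' | hi'
    · exact Or.inl hi'
    rcases hj' with hj' | hj'
    · exact Or.inr hj'
    · exact absurd ⟨hi', hj'⟩ hnot

theorem wp_computeSentinel (hL : n + 10 < L.wordBound) (hC : n + 2 ≤ L.cells)
    (hP : Represents P n X Y) (hctx : Ctx P X Y n 0 w₀ m) :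
    WP L computeSentinel m fun t m' => t ≤ 50 * (n + 2) ∧ ∃ M, 0 ≤ M ∧ Ctx P X Y n M w₀ m' ∧
      ∀ p ∈ P, 8 * |p.1| + 1 ≤ M ∧ 8 * |p.2| + 1 ≤ M := by
  rw [computeSentinel]
  refine wp_forLoop n 30 (fun v m' => ∃ M, 0 ≤ M ∧ Ctx P X Y n M w₀ m' ∧
    ∀ q < v, 8 * |X q| + 1 ≤ M ∧ 8 * |Y q| + 1 ≤ M) (by omega) ?_ ?_ ?_ ?_
  · exact ⟨0, le_rfl, hctx.setWord (by norm_num) _, fun q hq => by omega⟩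
  · rintro v m' hv ⟨M, -, h, -⟩
    have := h.size
    simp only [WordExp.Legal, WordExp.val]
    omega
  · rintro v m' hv hmv ⟨M, hM, h, hbd⟩
    simp only [wp_setReal, RealExp.Legal, WordExp.Legal, RealExp.val, WordExp.val,
      RealExp.cost, WordExp.cost]
    have h1 : v < L.wordBound := by omega
    have h2 : v < L.cells := by omega
    simp [hmv, h.arrX, h.arrY, h.sentinel, h1, h2]
    have hsq : ∀ x : ℝ, 8 * |x| + 1 ≤ 4 * (x * x) + 5 := by
      intro x
      rw [← abs_mul_abs_self x]
      nlinarith [sq_nonneg (|x| - 1)]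
    have hx := hsq (X v)
    have hy := hsq (Y v)
    have hx' := mul_self_nonneg (X v)
    have hy' := mul_self_nonneg (Y v)
    refine ⟨M + (4 * (X v * X v) + (4 * (Y v * Y v) + 5)), by linarith,
      ⟨⟨h.best.nonneg, h.best.valid⟩, h.le_best, h.size, h.arrX, h.arrY, by simp⟩, fun q hq => ?_⟩
    rcases Nat.lt_or_eq_of_le hq with hq | rfl
    · have := hbd q hq
      constructor <;> linarith
    · constructor <;> linarith
  · rintro t m' ht ⟨M, hM, h, hbd⟩
    simp only [WordExp.cost] at ht
    refine ⟨by omega, M, hM, h, fun p hp => ?_⟩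
    obtain ⟨q, hq, h1, h2⟩ := hP.exists_index p hp
    rw [← h1, ← h2]
    exact hbd q hq

theorem wp_maxWidthAnnulus (hL : n + 10 < L.wordBound) (hC : n + 2 ≤ L.cells)
    (hP : Represents P n X Y) (hfin : P.Finite) (hctx : Ctx P X Y n 0 0 m) :
    WP L maxWidthAnnulus m fun t m' => t ≤ 5000 * (n + 2) ^ 3 ∧ BestValid P m' ∧
      ∀ cx cy r s, IsCandidate P cx cy r s → r - s ≤ m'.realReg 4 := by
  have himage : Prod.swap '' (Prod.swap '' P) = P := by
    rw [← Set.image_comp]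
    simp
  simp only [maxWidthAnnulus, wp_seq]
  refine (wp_computeSentinel hL hC hP hctx).mono ?_
  rintro t₁ m₁ ⟨ht₁, M, hM, hctx₁, hPM⟩
  have hPM' : ∀ p ∈ P, |p.1| ≤ M ∧ |p.2| ≤ M := by
    intro p hp
    have := hPM p hp
    have := abs_nonneg p.1
    have := abs_nonneg p.2
    constructor <;> linarith
  refine (wp_searchStrips hL hC hP hM hPM' hctx₁).mono ?_
  rintro t₂ m₂ ⟨ht₂, X₂, Y₂, hctx₂, hP₂, hopt₂⟩
  refine (wp_searchStrips (w₀ := m₂.realReg 4) hL hC hP₂ hM ?_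
    ⟨hctx₂.best, le_rfl, hctx₂.size, hctx₂.arrX, hctx₂.arrY, hctx₂.sentinel⟩).mono ?_
  · rintro _ ⟨p, hp, rfl⟩
    exact (hPM' p hp).symm
  rintro t₃ m₃ ⟨ht₃, X₃, Y₃, hctx₃, hP₃, hopt₃⟩
  rw [himage] at hctx₃
  refine ⟨?_, hctx₃.best, fun cx cy r s hc => ?_⟩
  · have : 4 * (n + 2) ≤ (n + 2) ^ 3 := by
      rw [pow_succ]
      nlinarith [Nat.zero_le n, sq_nonneg n]
    omega
  · have hpos := hc.lt
    rcases hc.feasible_or hfin hPM with hf | hf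
    · exact (hopt₂ _ (by linarith) hf).trans hctx₃.le_best
    · exact hopt₃ _ (by linarith) hf

end Specs

end RealRAM

/-- There is one real-RAM program that, on every set of `n ≥ 2` points of the plane, outputs
a maximum-width valid empty axis-parallel square annulus in at most `C * n ^ 3` steps, while it uses
at most `C * n` cells of each of its (finitely many) arrays and only words below `n ^ C`. -/
theorem mainTheorem1 :
    ∃ (prog : RealRAM.Program) (C : ℕ),
      ∀ (n : ℕ) (p : Fin n → ℝ × ℝ), 2 ≤ n → Function.Injective p →
        ∃ (t : ℕ) (m : RealRAM.Memory),
          RealRAM.Run ⟨C * n, n ^ C⟩ prog (RealRAM.Memory.input p) t m ∧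
          t ≤ C * n ^ 3 ∧
          ∃ A : SquareAnnulus, m.Outputs A ∧ A.IsMaxWidthValidEmpty (Set.range p) := by
  obtain ⟨C, hC⟩ : ∃ C, 40000 ≤ C := ⟨_, le_rfl⟩
  refine ⟨RealRAM.maxWidthAnnulus, C, fun n p hn hp => ?_⟩
  have hfin : (Set.range p).Finite := Set.finite_range p
  have hword : n + 10 < n ^ C := by
    have h1 : n ^ 5 ≤ n ^ C := Nat.pow_le_pow_right (by omega) (by omega)
    have h2 : 2 ^ 4 ≤ n ^ 4 := Nat.pow_le_pow_left hn 4
    have h3 : n ^ 5 = n ^ 4 * n := pow_succ n 4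
    nlinarith
  have hrep : RealRAM.Represents (Set.range p) n ((RealRAM.Memory.input p).realArr 0)
      ((RealRAM.Memory.input p).realArr 1) := by
    refine ⟨fun i hi => ⟨⟨i, hi⟩, by simp [RealRAM.Memory.input, hi]⟩, ?_⟩
    rintro _ ⟨i, rfl⟩
    exact ⟨i, i.2, by simp [RealRAM.Memory.input], by simp [RealRAM.Memory.input]⟩
  obtain ⟨t, m, hrun, ht, hbest, hmax⟩ := RealRAM.wp_maxWidthAnnulus
    (L := ⟨C * n, n ^ C⟩) (m := RealRAM.Memory.input p) hword (show n + 2 ≤ C * n by nlinarith) hrep hfin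
    ⟨⟨le_rfl, Or.inl rfl⟩, le_rfl, rfl, rfl, rfl, rfl⟩
  have hne : p ⟨0, by omega⟩ ≠ p ⟨1, by omega⟩ := fun h => by simpa using hp h
  obtain ⟨cx, cy, r, s, hc⟩ := exists_isCandidate hfin ⟨_, rfl⟩ ⟨_, rfl⟩ hne
  have hpos : 0 < m.realReg 4 := lt_of_lt_of_le (sub_pos.2 hc.lt) (hmax cx cy r s hc)
  obtain ⟨hcand, hwidth⟩ := hbest.valid.resolve_left hpos.ne'
  refine ⟨t, m, hrun, ht.trans ?_, ⟨(m.realReg 0, m.realReg 1), m.realReg 2, m.realReg 3,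
    hcand.nonneg, hcand.lt.le⟩, ⟨rfl, rfl, rfl, rfl⟩, ?_⟩
  · calc 5000 * (n + 2) ^ 3 ≤ 5000 * (2 * n) ^ 3 := by gcongr; omega
      _ = 40000 * n ^ 3 := by ring
      _ ≤ C * n ^ 3 := Nat.mul_le_mul_right _ hC
  · have hA := (SquareAnnulus.emptyValid_iff ⟨(m.realReg 0, m.realReg 1), m.realReg 2, m.realReg 3,
      hcand.nonneg, hcand.lt.le⟩ (Set.range p) (by rw [SquareAnnulus.width]; linarith)).2 hcand
    refine ⟨hA.1, hA.2, fun B hB hB' => ?_⟩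
    have hw : SquareAnnulus.width ⟨(m.realReg 0, m.realReg 1), m.realReg 2, m.realReg 3,
      hcand.nonneg, hcand.lt.le⟩ = m.realReg 4 := hwidth
    rw [hw]
    rcases le_or_gt B.width 0 with h0 | h0
    · exact h0.trans hpos.le
    · exact hmax _ _ _ _ ((B.emptyValid_iff _ h0).1 ⟨hB, hB'⟩)
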